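/- Let $\lambda$ denote Lebesgue measure on $\mathbb R$. A set $C\subseteq\mathbb R$ is called symmetric if there is a real number $c$ such that, for all real $x$, $c+x\in C$ if and only if $c-x\in C$. For $0<\varepsilon\le 1$ let $$\Delta(\varepsilon)=\sup\{\delta\ge 0:\ \text{every measurable } A\subseteq[0,1)\text{ with }\lambda(A)=\varepsilon\text{ contains a measurable symmetric subset } C \text{ with }\lambda(C)=\delta\}.$$ Then: (i) $\Delta(\varepsilon)=2\varepsilon-1$ for $\frac{11}{16}\le\varepsilon\le1$, and $\Delta(\varepsilon)\ge 2\varepsilon-1$ for $\frac12\le\varepsilon\le\frac{11}{16}$; (ii) $\Delta(\varepsilon)\ge 0.591389\,\varepsilon^2$ for all $0<\varepsilon\le1$; (iii) $\Delta(\varepsilon)\ge 0.5546\,\varepsilon^2+0.088079\,\varepsilon^3$ for all $0<\varepsilon\le1$; (iv) $\Delta(\varepsilon)\le\frac{96}{121}\varepsilon^2<0.7934\,\varepsilon^2$ for all $0<\varepsilon\le\frac{11}{16}$; (v) $\Delta(\varepsilon)\le\dfrac{\pi\varepsilon^2}{(1+\sqrt{1-\varepsilon})^2}$ for all $0<\varepsilon\le1$,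 and $\dfrac{\pi\varepsilon^2}{(1+\sqrt{1-\varepsilon})^2}=\frac{\pi}{4}\varepsilon^2+O(\varepsilon^3)$, where the implied constant is absolute and the estimate holds uniformly for $0<\varepsilon\le1$. -/

import Mathlib

open MeasureTheory

/-- A set of reals is symmetric if it is invariant under some reflection `c + x ↦ c - x`. -/
def IsSymmetricSet (C : Set ℝ) : Prop :=
  ∃ c : ℝ, ∀ x : ℝ, c + x ∈ C ↔ c - x ∈ C

/-- The numbers `δ ≥ 0` such that every measurable subset of `[0,1)` with measure `ε` contains a
symmetric subset with measure `δ`. Measurable means Lebesgue measurable, that is, null-measurable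
for `volume`. -/
def guaranteedMeasures (ε : ℝ) : Set ℝ :=
  {δ : ℝ | 0 ≤ δ ∧ ∀ A : Set ℝ, A ⊆ Set.Ico (0 : ℝ) 1 → NullMeasurableSet A volume →
    volume A = ENNReal.ofReal ε →
      ∃ C : Set ℝ, C ⊆ A ∧ IsSymmetricSet C ∧ NullMeasurableSet C volume ∧
        volume C = ENNReal.ofReal δ}

/-- `Δ(ε)`: the supremum of the measures `δ` that are guaranteed for sets of measure `ε`. -/
noncomputable def symDelta (ε : ℝ) : ℝ :=
  sSup (guaranteedMeasures ε)

/-- For `0 ≤ ε ≤ 1` the supremum defining `Δ(ε)` is over a nonempty set bounded above. -/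
theorem guaranteedMeasures_nonempty_bddAbove (ε : ℝ) (h0 : 0 ≤ ε) (h1 : ε ≤ 1) :
    (guaranteedMeasures ε).Nonempty ∧ BddAbove (guaranteedMeasures ε) := by
  refine ⟨⟨0, le_rfl, fun A _ _ _ => ⟨∅, Set.empty_subset _, ⟨0, by simp⟩, by simp, by simp⟩⟩,
    ⟨ε, ?_⟩⟩
  rintro δ ⟨-, h⟩
  obtain ⟨C, hCA, -, -, hC⟩ := h (Set.Ico 0 ε) (Set.Ico_subset_Ico_right h1)
    measurableSet_Ico.nullMeasurableSet (by simp)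
  have := measure_mono (μ := volume) hCA
  rw [hC, Real.volume_Ico, sub_zero] at this
  exact (ENNReal.ofReal_le_ofReal_iff h0).1 this

/-!
Lower bounds. The largest subset of `A` that is symmetric about `s / 2` has measure
`(f ⋆ f) s`, where `f` is the indicator of `A`. If `f ⋆ f ≤ D` everywhere, then the autocorrelation
`F` of `f`, which has the same `L²` norm as `f ⋆ f`, satisfies `‖F‖₂² ≤ D ‖f‖₁²`. Let `I` be the
indicator of a short interval, with autocorrelation `k`, and let `h = f ⋆ I`. Pairing `F` with an
affine function of `k` bounds `‖F‖₂²` from below in terms of `‖h‖₂² = ∫ F k`. As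
`h ⋆ h = (f ⋆ f) ⋆ (I ⋆ I)` is also at most a multiple of `D`, comparing `h x + h (c - x)` with a
constant bounds `‖h‖₂²` from below. Together these give `Δ(ε) ≥ 0.609 ε²`. The bound
`Δ(ε) ≥ 2ε - 1` is inclusion–exclusion for `A` and its reflection `1 - A`, and the cubic bound
follows from these two.

Upper bounds. A density `p : [0, 1] → [0, 1]` sampled on `N` cells can be rounded to a union of
cells by the method of conditional expectations, which changes the mass and all values of the
self-convolution by `o(N)` cells. A step density on eight blocks yields `96/121`, and the density
`min 1 (b / √x)`, whose self-convolution is at most `b² ∫₀ˢ dx / √(x (s - x)) = π b²`, yields the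
bound with `π`.
-/

open scoped ENNReal NNReal Pointwise

section Convolution

open Function

variable {G : Type*} [MeasurableSpace G] [AddCommGroup G] {μ : Measure G} {f g h k : G → ℝ≥0∞}

/-- The autocorrelation `x ↦ ∫ f (y + x) f y dy`, written as the convolution of `f` with its
reversal `y ↦ f (-y)`. -/
noncomputable def autocorr (f : G → ℝ≥0∞) (μ : Measure G) : G → ℝ≥0∞ :=
  f ⋆ₗ[μ] fun x => f (-x)

theorem support_lconvolution_subset : support (f ⋆ₗ[μ] g) ⊆ support f + support g := by
  intro x hx
  by_contra hnot
  refine hx (lintegral_eq_zero_of_ae_eq_zero (.of_forall fun y => ?_))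
  by_contra hy
  exact hnot ⟨y, left_ne_zero_of_mul hy, -y + x, right_ne_zero_of_mul hy, add_neg_cancel_left y x⟩

theorem lintegral_mul_eq_lconvolution_zero :
    ∫⁻ x, f x * g x ∂μ = (f ⋆ₗ[μ] fun x => g (-x)) 0 := by
  simp [lconvolution_def]

theorem lintegral_lconvolution [MeasurableAdd₂ G] [MeasurableNeg G] [SFinite μ]
    [μ.IsAddLeftInvariant] (hf : Measurable f) (hg : Measurable g) :
    ∫⁻ x, (f ⋆ₗ[μ] g) x ∂μ = (∫⁻ x, f x ∂μ) * ∫⁻ x, g x ∂μ := by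
  simp only [lconvolution_def]
  rw [lintegral_lintegral_swap (by fun_prop), ← lintegral_mul_const _ hf]
  refine lintegral_congr fun y => ?_
  rw [lintegral_const_mul _ (by fun_prop), lintegral_add_left_eq_self]

theorem measurable_autocorr [MeasurableAdd₂ G] [MeasurableNeg G] [SFinite μ] (hf : Measurable f) :
    Measurable (autocorr f μ) := by
  unfold autocorr
  fun_prop

variable [MeasurableNeg G] [μ.IsNegInvariant]

theorem lconvolution_comp_neg (x : G) :
    (f ⋆ₗ[μ] g) (-x) = ((fun y => f (-y)) ⋆ₗ[μ] fun y => g (-y)) x := by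
  simp only [lconvolution_def]
  rw [← lintegral_neg_eq_self]
  simp [add_comm]

variable [MeasurableAdd₂ G] [μ.IsAddLeftInvariant]

theorem lconvolution_le_mul_lintegral (hg : Measurable g) {D : ℝ≥0∞} (hf : ∀ x, f x ≤ D) (x : G) :
    (f ⋆ₗ[μ] g) x ≤ D * ∫⁻ y, g y ∂μ :=
  calc (f ⋆ₗ[μ] g) x = ∫⁻ y, g y * f (-y + x) ∂μ := by rw [lconvolution_comm]; rfl
    _ ≤ ∫⁻ y, D * g y ∂μ := lintegral_mono fun y => by rw [mul_comm D]; gcongr; exact hf _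
    _ = D * ∫⁻ y, g y ∂μ := lintegral_const_mul _ hg

theorem autocorr_neg (x : G) : autocorr f μ (-x) = autocorr f μ x := by
  rw [autocorr, lconvolution_comp_neg, lconvolution_comm]
  simp only [neg_neg]

variable [SFinite μ]

theorem lintegral_autocorr (hf : Measurable f) :
    ∫⁻ x, autocorr f μ x ∂μ = (∫⁻ x, f x ∂μ) ^ 2 := by
  rw [autocorr, lintegral_lconvolution hf (by fun_prop), lintegral_neg_eq_self f, sq]

theorem lconvolution_lconvolution_lconvolution_comm (hf : Measurable f) (hg : Measurable g)
    (hh : Measurable h) (hk : Measurable k) :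
    (f ⋆ₗ[μ] g) ⋆ₗ[μ] (h ⋆ₗ[μ] k) = (f ⋆ₗ[μ] h) ⋆ₗ[μ] (g ⋆ₗ[μ] k) := by
  rw [← lconvolution_assoc hf hg (by fun_prop), ← lconvolution_assoc hf hh (by fun_prop),
    lconvolution_assoc hg hh hk, lconvolution_comm (f := g) (g := h),
    ← lconvolution_assoc hh hg hk]

theorem lintegral_lconvolution_sq (hf : Measurable f) (hg : Measurable g) :
    ∫⁻ x, (f ⋆ₗ[μ] g) x ^ 2 ∂μ = ∫⁻ x, autocorr f μ x * autocorr g μ x ∂μ := by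
  have hfneg : Measurable fun x => f (-x) := by fun_prop
  have hgneg : Measurable fun x => g (-x) := by fun_prop
  calc ∫⁻ x, (f ⋆ₗ[μ] g) x ^ 2 ∂μ
      = ((f ⋆ₗ[μ] g) ⋆ₗ[μ] ((fun x => f (-x)) ⋆ₗ[μ] fun x => g (-x))) 0 := by
        simp only [sq, lintegral_mul_eq_lconvolution_zero, lconvolution_comp_neg]
    _ = (autocorr f μ ⋆ₗ[μ] autocorr g μ) 0 := by
        rw [lconvolution_lconvolution_lconvolution_comm hf hg hfneg hgneg]; rfl
    _ = ∫⁻ x, autocorr f μ x * autocorr g μ x ∂μ := by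
        simp only [lintegral_mul_eq_lconvolution_zero, autocorr_neg]

theorem lintegral_autocorr_sq_le (hf : Measurable f) {D : ℝ≥0∞}
    (hD : ∀ x, (f ⋆ₗ[μ] f) x ≤ D) : ∫⁻ x, autocorr f μ x ^ 2 ∂μ ≤ D * (∫⁻ x, f x ∂μ) ^ 2 :=
  calc ∫⁻ x, autocorr f μ x ^ 2 ∂μ = ∫⁻ x, (f ⋆ₗ[μ] f) x ^ 2 ∂μ := by
        simp only [lintegral_lconvolution_sq hf hf, sq (autocorr f μ _)]
    _ ≤ ∫⁻ x, D * (f ⋆ₗ[μ] f) x ∂μ := lintegral_mono fun x => by rw [sq]; gcongr; exact hD x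
    _ = D * (∫⁻ x, f x ∂μ) ^ 2 := by
        rw [lintegral_const_mul _ (by fun_prop), lintegral_lconvolution hf hf, sq]

theorem lintegral_lconvolution_mul_sub_le (hf : Measurable f) (hg : Measurable g) {D : ℝ≥0∞}
    (hD : ∀ x, (f ⋆ₗ[μ] f) x ≤ D) (c : G) :
    ∫⁻ x, (f ⋆ₗ[μ] g) x * (f ⋆ₗ[μ] g) (c - x) ∂μ ≤ D * (∫⁻ x, g x ∂μ) ^ 2 :=
  calc ∫⁻ x, (f ⋆ₗ[μ] g) x * (f ⋆ₗ[μ] g) (c - x) ∂μ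
      = ((f ⋆ₗ[μ] g) ⋆ₗ[μ] (f ⋆ₗ[μ] g)) c := by simp [lconvolution_def, neg_add_eq_sub]
    _ = ((f ⋆ₗ[μ] f) ⋆ₗ[μ] (g ⋆ₗ[μ] g)) c := by
        rw [lconvolution_lconvolution_lconvolution_comm hf hg hf hg]
    _ ≤ D * ∫⁻ x, (g ⋆ₗ[μ] g) x ∂μ := lconvolution_le_mul_lintegral (by fun_prop) hD c
    _ = D * (∫⁻ x, g x ∂μ) ^ 2 := by rw [lintegral_lconvolution hg hg, sq]

end Convolution

theorem two_mul_mul_le_sq_add_sq (a b : ℝ≥0∞) : 2 * (a * b) ≤ a ^ 2 + b ^ 2 := by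
  wlog hab : a ≤ b generalizing a b
  · rw [mul_comm a, add_comm]
    exact this b a (le_of_not_ge hab)
  obtain ⟨c, rfl⟩ := exists_add_of_le hab
  calc 2 * (a * (a + c)) ≤ 2 * (a * (a + c)) + c ^ 2 := le_self_add
    _ = a ^ 2 + (a + c) ^ 2 := by ring

theorem two_mul_lintegral_mul_le {α : Type*} [MeasurableSpace α] {μ : Measure α} {S : Set α}
    (hS : MeasurableSet S) {f φ : α → ℝ≥0∞} (hf : Measurable f) (hfS : Function.support f ⊆ S) :
    2 * ∫⁻ x, f x * φ x ∂μ ≤ ∫⁻ x, f x ^ 2 ∂μ + ∫⁻ x in S, φ x ^ 2 ∂μ := by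
  rw [← lintegral_const_mul' _ _ ENNReal.ofNat_ne_top, ← lintegral_indicator hS,
    ← lintegral_add_left (hf.pow_const 2)]
  refine lintegral_mono fun x => ?_
  by_cases hx : x ∈ S
  · simpa only [Set.indicator_of_mem hx] using two_mul_mul_le_sq_add_sq (f x) (φ x)
  · simp [Function.notMem_support.1 fun h => hx (hfS h)]

section UnitInterval

open Function Set

theorem autocorr_indicator_Icc (d t : ℝ) :
    autocorr ((Icc 0 d).indicator 1) volume t = ENNReal.ofReal (d - |t|) := by
  have hmem (x : ℝ) : x ∈ Icc (max 0 t) (min d (d + t)) ↔ x ∈ Icc 0 d ∧ x - t ∈ Icc 0 d := by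
    grind
  have hprod (x : ℝ) : (Icc 0 d).indicator (1 : ℝ → ℝ≥0∞) x * (Icc 0 d).indicator 1 (-(-x + t)) =
      (Icc (max 0 t) (min d (d + t))).indicator 1 x := by
    rw [neg_add, neg_neg, ← sub_eq_add_neg]
    by_cases h1 : x ∈ Icc 0 d <;> by_cases h2 : x - t ∈ Icc 0 d <;> simp [indicator, hmem, h1, h2]
  have hlength : min d (d + t) - max 0 t = d - |t| := by grind
  simp only [autocorr, lconvolution_def]
  rw [lintegral_congr hprod, lintegral_indicator_one measurableSet_Icc, Real.volume_Icc, hlength]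

theorem integral_max_sub_abs_sq {d : ℝ} (hd : 0 ≤ d) :
    ∫ t, max (d - |t|) 0 ^ 2 = 2 / 3 * d ^ 3 := by
  have hvanish : ∀ t ∈ Ioi 0 \ Ioc 0 d, max (d - t) 0 ^ 2 = 0 := by
    rintro t ⟨ht0, ht⟩
    rw [max_eq_right (by grind), zero_pow two_ne_zero]
  calc ∫ t, max (d - |t|) 0 ^ 2 = 2 * ∫ t in Ioi 0, max (d - t) 0 ^ 2 :=
        integral_comp_abs (f := fun t => max (d - t) 0 ^ 2)
    _ = 2 * ∫ t in Ioc 0 d, max (d - t) 0 ^ 2 := by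
        rw [setIntegral_eq_of_subset_of_forall_sdiff_eq_zero measurableSet_Ioi Ioc_subset_Ioi_self
          hvanish]
    _ = 2 * ∫ t in Ioc 0 d, (d - t) ^ 2 := by
        rw [setIntegral_congr_fun measurableSet_Ioc fun t ht => ?_]
        simp only [max_eq_left (sub_nonneg.2 ht.2)]
    _ = 2 / 3 * d ^ 3 := by
        rw [← intervalIntegral.integral_of_le hd,
          intervalIntegral.integral_comp_sub_left (fun x => x ^ 2), integral_pow]
        norm_num
        ring

theorem lintegral_autocorr_indicator_Icc_sq {d : ℝ} (hd : 0 ≤ d) :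
    ∫⁻ t, autocorr ((Icc 0 d).indicator 1) volume t ^ 2 = ENNReal.ofReal (2 / 3 * d ^ 3) := by
  have hcont : Continuous fun t : ℝ => max (d - |t|) 0 ^ 2 := by fun_prop
  have hsupp : HasCompactSupport fun t : ℝ => max (d - |t|) 0 ^ 2 :=
    .intro (isCompact_Icc (a := -d) (b := d)) fun t ht => by
      rw [max_eq_right (by grind), zero_pow two_ne_zero]
  have hsq (t : ℝ) : autocorr ((Icc 0 d).indicator 1) volume t ^ 2 =
      ENNReal.ofReal (max (d - |t|) 0 ^ 2) := by
    rw [autocorr_indicator_Icc, ENNReal.ofReal_pow (le_max_right _ _), ENNReal.ofReal_max,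
      ENNReal.ofReal_zero, max_eq_left zero_le]
  rw [lintegral_congr hsq, ← ofReal_integral_eq_lintegral_ofReal
    (hcont.integrable_of_hasCompactSupport hsupp) (.of_forall fun t => sq_nonneg _),
    integral_max_sub_abs_sq hd]

theorem lintegral_add_comp_sub_left_sq {h : ℝ → ℝ≥0∞} (hh : Measurable h) (c : ℝ) :
    ∫⁻ x, (h x + h (c - x)) ^ 2 =
      2 * (∫⁻ x, h x ^ 2) + 2 * ∫⁻ x, h x * h (c - x) := by
  have hexpand (x : ℝ) : (h x + h (c - x)) ^ 2 =
      h x ^ 2 + h (c - x) ^ 2 + 2 * (h x * h (c - x)) := by ring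
  simp only [hexpand]
  rw [lintegral_add_left (by fun_prop), lintegral_add_left (by fun_prop),
    lintegral_const_mul _ (by fun_prop), lintegral_sub_left_eq_self (fun x => h x ^ 2), ← two_mul]

theorem four_mul_mul_lintegral_le {h : ℝ → ℝ≥0∞} (hh : Measurable h) {c : ℝ≥0}
    (hsupp : support h ⊆ Icc 0 (c : ℝ)) (κ : ℝ≥0∞) :
    4 * κ * ∫⁻ x, h x ≤
      2 * (∫⁻ x, h x ^ 2) + 2 * (∫⁻ x, h x * h (c - x)) + κ ^ 2 * c := by
  have hsupp' : support (fun x => h x + h (c - x)) ⊆ Icc 0 (c : ℝ) := by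
    refine (support_add h fun x => h (c - x)).trans (union_subset hsupp fun x hx => ?_)
    have := hsupp (mem_support.2 hx)
    grind
  calc 4 * κ * ∫⁻ x, h x = 2 * ∫⁻ x, (h x + h (c - x)) * κ := by
        rw [lintegral_mul_const _ (by fun_prop), lintegral_add_left hh, lintegral_sub_left_eq_self]
        ring
    _ ≤ (∫⁻ x, (h x + h (c - x)) ^ 2) + ∫⁻ _ in Icc 0 (c : ℝ), κ ^ 2 :=
        two_mul_lintegral_mul_le (φ := fun _ => κ) measurableSet_Icc (by fun_prop) hsupp'
    _ = _ := by
        rw [lintegral_add_comp_sub_left_sq hh, setLIntegral_const, Real.volume_Icc, sub_zero,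
          ENNReal.ofReal_coe_nnreal]

theorem support_autocorr_subset_Icc {f : ℝ → ℝ≥0∞} (hf : support f ⊆ Icc 0 1) :
    support (autocorr f volume) ⊆ Icc (-1) 1 := by
  have hneg : support (fun x => f (-x)) ⊆ Icc (-1) 0 := fun x hx => by
    have := hf (mem_support.2 hx)
    grind
  calc support (autocorr f volume) ⊆ Icc 0 1 + Icc (-1) 0 :=
        support_lconvolution_subset.trans (add_subset_add hf hneg)
    _ ⊆ Icc (-1) 1 := by simpa using Icc_add_Icc_subset (0 : ℝ) 1 (-1) 0

theorem setLIntegral_affine_autocorr_sq_le {g : ℝ → ℝ≥0∞} (hg : Measurable g) (α β : ℝ≥0∞) :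
    ∫⁻ t in Icc (-1) 1, (β * autocorr g volume t + α) ^ 2 ≤
      β ^ 2 * (∫⁻ t, autocorr g volume t ^ 2) + 2 * α * β * (∫⁻ x, g x) ^ 2 + 2 * α ^ 2 := by
  have hmeas := measurable_autocorr (μ := volume) hg
  have hexpand (t : ℝ) : (β * autocorr g volume t + α) ^ 2 =
      β ^ 2 * autocorr g volume t ^ 2 + 2 * α * β * autocorr g volume t + α ^ 2 := by ring
  simp only [hexpand]
  rw [lintegral_add_right _ measurable_const, lintegral_add_left (by fun_prop),
    lintegral_const_mul _ (by fun_prop), lintegral_const_mul _ hmeas, setLIntegral_const,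
    Real.volume_Icc, ← lintegral_autocorr hg, mul_comm (α ^ 2)]
  gcongr
  · exact Measure.restrict_le_self
  · exact Measure.restrict_le_self
  · norm_num

theorem two_mul_lintegral_lconvolution_sq_add_le {f g : ℝ → ℝ≥0∞} (hf : Measurable f)
    (hg : Measurable g) (hsupp : support f ⊆ Icc 0 1) (α β : ℝ≥0∞) :
    2 * (β * (∫⁻ x, (f ⋆ₗ g) x ^ 2) + α * (∫⁻ x, f x) ^ 2) ≤
      (∫⁻ t, autocorr f volume t ^ 2) +
        (β ^ 2 * (∫⁻ t, autocorr g volume t ^ 2) + 2 * α * β * (∫⁻ x, g x) ^ 2 + 2 * α ^ 2) := by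
  have hF := measurable_autocorr (μ := volume) hf
  have hk := measurable_autocorr (μ := volume) hg
  have hexpand (t : ℝ) : autocorr f volume t * (β * autocorr g volume t + α) =
      β * (autocorr f volume t * autocorr g volume t) + α * autocorr f volume t := by ring
  rw [lintegral_lconvolution_sq hf hg, ← lintegral_autocorr hf, ← lintegral_const_mul _ hF,
    ← lintegral_const_mul _ (by fun_prop), ← lintegral_add_left (by fun_prop)]
  simp only [← hexpand]
  refine (two_mul_lintegral_mul_le measurableSet_Icc hF (support_autocorr_subset_Icc hsupp)).trans
    ?_
  gcongr
  exact setLIntegral_affine_autocorr_sq_le hg α β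

theorem le_mul_of_lconvolution_self_le {f : ℝ → ℝ≥0∞} (hf : Measurable f)
    (hsupp : support f ⊆ Icc 0 1) {D : ℝ≥0∞} (hD : ∀ s, (f ⋆ₗ f) s ≤ D) (d : ℝ≥0)
    (α β κ : ℝ≥0∞) :
    β * (4 * κ * ((∫⁻ x, f x) * d)) + 2 * α * (∫⁻ x, f x) ^ 2 ≤
      D * ((∫⁻ x, f x) ^ 2 + 2 * β * d ^ 2) + β ^ 2 * ENNReal.ofReal (2 / 3 * d ^ 3) +
        2 * α * β * d ^ 2 + 2 * α ^ 2 + β * κ ^ 2 * (1 + d) := by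
  set I : ℝ → ℝ≥0∞ := (Icc 0 (d : ℝ)).indicator 1 with hI
  have hImeas : Measurable I := measurable_one.indicator measurableSet_Icc
  have hIint : ∫⁻ x, I x = d := by simp [hI]
  have hsmooth : Measurable (f ⋆ₗ I) := by fun_prop
  have hsmooth_supp : support (f ⋆ₗ I) ⊆ Icc 0 ((1 + d : ℝ≥0) : ℝ) :=
    calc support (f ⋆ₗ I) ⊆ Icc 0 1 + Icc 0 (d : ℝ) :=
          support_lconvolution_subset.trans (add_subset_add hsupp support_indicator_subset)
      _ ⊆ Icc 0 ((1 + d : ℝ≥0) : ℝ) := by simpa using Icc_add_Icc_subset 0 1 0 (d : ℝ)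
  have hconst := four_mul_mul_lintegral_le hsmooth hsmooth_supp κ
  have hcorr := two_mul_lintegral_lconvolution_sq_add_le hf hImeas hsupp α β
  rw [lintegral_lconvolution hf hImeas, hIint] at hconst
  rw [lintegral_autocorr_indicator_Icc_sq d.coe_nonneg, hIint] at hcorr
  have hrefl := lintegral_lconvolution_mul_sub_le hf hImeas hD ((1 + d : ℝ≥0) : ℝ)
  have hsq := lintegral_autocorr_sq_le hf hD
  rw [hIint] at hrefl
  calc β * (4 * κ * ((∫⁻ x, f x) * d)) + 2 * α * (∫⁻ x, f x) ^ 2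
      ≤ β * (2 * (∫⁻ x, (f ⋆ₗ I) x ^ 2) + 2 * (D * d ^ 2) + κ ^ 2 * (1 + d : ℝ≥0)) +
          2 * α * (∫⁻ x, f x) ^ 2 := by
        gcongr
        exact hconst.trans (by gcongr)
    _ = 2 * (β * (∫⁻ x, (f ⋆ₗ I) x ^ 2) + α * (∫⁻ x, f x) ^ 2) +
          (2 * β * (D * d ^ 2) + β * κ ^ 2 * (1 + d)) := by push_cast; ring
    _ ≤ D * (∫⁻ x, f x) ^ 2 + (β ^ 2 * ENNReal.ofReal (2 / 3 * d ^ 3) + 2 * α * β * d ^ 2 +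
          2 * α ^ 2) + (2 * β * (D * d ^ 2) + β * κ ^ 2 * (1 + d)) := by
        gcongr
        exact hcorr.trans (by gcongr)
    _ = _ := by ring

theorem mul_sq_le_of_lconvolution_self_le {f : ℝ → ℝ≥0∞} (hf : Measurable f)
    (hsupp : support f ⊆ Icc 0 1) {e D : ℝ≥0} (he : ∫⁻ x, f x = e)
    (hD : ∀ s, (f ⋆ₗ f) s ≤ D) : 0.609 * e ^ 2 ≤ D := by
  -- The best constant to compare `h x + h (c - x)` with, for `h = f ⋆ₗ I` and `c = 1 + d`, is its
  -- mean, and this is `κ`; the other three parameters are numerically close to optimal.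
  have hineq := le_mul_of_lconvolution_self_le hf hsupp hD 0.23 (0.3942 * e ^ 2 : ℝ≥0)
    (4 * e ^ 2 : ℝ≥0) (2 * 0.23 * e / 1.23 : ℝ≥0)
  have hcast : ENNReal.ofReal (2 / 3 * (0.23 : ℝ≥0) ^ 3) = ((2 / 3 * 0.23 ^ 3 : ℝ≥0) : ℝ≥0∞) := by
    rw [← ENNReal.ofReal_coe_nnreal]
    push_cast
    rfl
  rw [he, hcast] at hineq
  norm_cast at hineq
  rw [← NNReal.coe_le_coe] at hineq ⊢
  push_cast at hineq ⊢
  rcases e.coe_nonneg.eq_or_lt with he0 | he0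
  · simp [← he0]
  · have : (e : ℝ) ^ 2 * (0.609 * e ^ 2) ≤ e ^ 2 * D := by
      norm_num at hineq ⊢
      nlinarith [sq_nonneg ((e : ℝ) ^ 2)]
    exact le_of_mul_le_mul_left this (by positivity)

end UnitInterval

section SymmetricPart

open Set Metric

theorem lipschitzWith_measureReal_inter_closedBall (B : Set ℝ) (c : ℝ) :
    LipschitzWith 2 fun r => volume.real (B ∩ closedBall c r) := by
  refine LipschitzWith.of_le_add_mul 2 fun r' r => ?_
  have hfin (ρ : ℝ) : volume (B ∩ closedBall c ρ) ≠ ∞ :=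
    ((measure_mono inter_subset_right).trans_lt measure_closedBall_lt_top).ne
  rcases le_total r' r with hle | hle
  · have := measureReal_mono (μ := volume)
      (inter_subset_inter_right B (closedBall_subset_closedBall (x := c) hle)) (hfin r)
    linarith [mul_nonneg (NNReal.coe_nonneg 2) (dist_nonneg (x := r') (y := r))]
  · have hcover : B ∩ closedBall c r' ⊆
        (B ∩ closedBall c r) ∪ (Icc (c - r') (c - r) ∪ Icc (c + r) (c + r')) := by
      intro x hx
      grind [Real.closedBall_eq_Icc]
    have hle' := (measureReal_mono (μ := volume) hcover
      (measure_union_ne_top (hfin r) (measure_union_ne_top (by simp) (by simp)))).trans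
        ((measureReal_union_le _ _).trans (add_le_add_right (measureReal_union_le _ _) _))
    rw [Real.volume_real_Icc_of_le (by linarith), Real.volume_real_Icc_of_le (by linarith)] at hle'
    rw [Real.dist_eq, abs_of_nonneg (by linarith)]
    push_cast
    linarith

theorem exists_volume_inter_closedBall_eq {B : Set ℝ} (hB : Bornology.IsBounded B) (c : ℝ)
    {δ : ℝ≥0∞} (hδ : δ ≤ volume B) : ∃ r, volume (B ∩ closedBall c r) = δ := by
  have hfin : volume B ≠ ∞ := hB.measure_lt_top.ne
  obtain ⟨R, hR⟩ := hB.subset_closedBall c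
  have hsmall : volume.real (B ∩ closedBall c (-1)) ≤ δ.toReal := by
    simp
  have hlarge : δ.toReal ≤ volume.real (B ∩ closedBall c R) := by
    rw [inter_eq_left.2 hR]
    exact ENNReal.toReal_mono hfin hδ
  obtain ⟨r, hr⟩ := mem_range_of_exists_le_of_exists_ge
    (lipschitzWith_measureReal_inter_closedBall B c).continuous ⟨_, hsmall⟩ ⟨_, hlarge⟩
  exact ⟨r, (ENNReal.toReal_eq_toReal_iff' (measure_ne_top_of_subset inter_subset_left hfin)
    (ne_top_of_le_ne_top hfin hδ)).1 hr⟩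

/-- The largest subset of `A` that is symmetric about `s / 2`. -/
def symmPart (A : Set ℝ) (s : ℝ) : Set ℝ := A ∩ (fun x => s - x) ⁻¹' A

variable {A B C : Set ℝ} {s : ℝ}

theorem symmPart_mono (h : A ⊆ B) : symmPart A s ⊆ symmPart B s :=
  inter_subset_inter h (preimage_mono h)

theorem measurableSet_symmPart (hA : MeasurableSet A) : MeasurableSet (symmPart A s) :=
  hA.inter (measurable_const_sub s hA)

theorem isSymmetricSet_symmPart_inter_closedBall (A : Set ℝ) (s r : ℝ) :
    IsSymmetricSet (symmPart A s ∩ closedBall (s / 2) r) := by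
  refine ⟨s / 2, fun x => ?_⟩
  have hadd : s - (s / 2 + x) = s / 2 - x := by ring
  have hsub : s - (s / 2 - x) = s / 2 + x := by ring
  simp [symmPart, hadd, hsub, and_comm]

theorem exists_subset_symmPart (hC : IsSymmetricSet C) (hCA : C ⊆ A) :
    ∃ s, C ⊆ symmPart A s := by
  obtain ⟨c, hc⟩ := hC
  refine ⟨2 * c, fun x hx => ⟨hCA hx, hCA ?_⟩⟩
  have hrefl : c - (x - c) ∈ C := (hc (x - c)).1 (by simpa using hx)
  convert hrefl using 1
  ring

theorem volume_preimage_sub_left (s : ℝ) (B : Set ℝ) :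
    volume ((fun x => s - x) ⁻¹' B) = volume B :=
  (Measure.measurePreserving_sub_left volume s).measure_preimage_equiv
    (f := MeasurableEquiv.subLeft s) B

theorem volume_symmPart_union_le (A B : Set ℝ) (s : ℝ) :
    volume (symmPart (A ∪ B) s) ≤ volume (symmPart A s) + 2 * volume B := by
  have hcover : symmPart (A ∪ B) s ⊆ symmPart A s ∪ (B ∪ (fun x => s - x) ⁻¹' B) := by
    rintro x ⟨hx, hsx⟩
    simp only [symmPart, mem_union, mem_preimage, mem_inter_iff] at *
    tauto
  calc volume (symmPart (A ∪ B) s)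
      ≤ volume (symmPart A s) + (volume B + volume ((fun x => s - x) ⁻¹' B)) :=
        (measure_mono hcover).trans
          ((measure_union_le _ _).trans (by gcongr; exact measure_union_le _ _))
    _ = volume (symmPart A s) + 2 * volume B := by
        rw [volume_preimage_sub_left, two_mul]

theorem lconvolution_indicator_self (hA : MeasurableSet A) (s : ℝ) :
    ((A.indicator 1 : ℝ → ℝ≥0∞) ⋆ₗ A.indicator 1) s = volume (symmPart A s) := by
  rw [← lintegral_indicator_one (measurableSet_symmPart hA), lconvolution_def]
  refine lintegral_congr fun x => ?_
  by_cases h1 : x ∈ A <;> by_cases h2 : s - x ∈ A <;>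
    simp [symmPart, indicator, h1, h2, neg_add_eq_sub]

theorem exists_volume_eq_and_symmPart_le (hA : A ⊆ Ico 0 1) (hAm : MeasurableSet A) {ε : ℝ≥0∞}
    (hε : ε ≤ 1) : ∃ A' ⊆ Ico (0 : ℝ) 1, MeasurableSet A' ∧ volume A' = ε ∧
      ∀ s, volume (symmPart A' s) ≤ volume (symmPart A s) + 2 * (ε - volume A) := by
  have hbdd : Bornology.IsBounded A := (isBounded_Ico 0 1).subset hA
  rcases le_total ε (volume A) with hle | hle
  · obtain ⟨r, hr⟩ := exists_volume_inter_closedBall_eq hbdd 0 hle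
    exact ⟨A ∩ closedBall 0 r, inter_subset_left.trans hA, hAm.inter measurableSet_closedBall, hr,
      fun s => (measure_mono (symmPart_mono inter_subset_left)).trans le_self_add⟩
  · have hroom : ε - volume A ≤ volume (Ico (0 : ℝ) 1 \ A) := by
      rw [measure_sdiff hA hAm.nullMeasurableSet hbdd.measure_lt_top.ne, Real.volume_Ico]
      gcongr
      simpa using hε
    obtain ⟨r, hr⟩ := exists_volume_inter_closedBall_eq ((isBounded_Ico 0 1).subset sdiff_subset) 0
      hroom
    have hm : MeasurableSet (Ico 0 1 \ A ∩ closedBall 0 r) :=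
      (measurableSet_Ico.diff hAm).inter measurableSet_closedBall
    refine ⟨A ∪ Ico 0 1 \ A ∩ closedBall 0 r,
      union_subset hA (inter_subset_left.trans sdiff_subset), hAm.union hm, ?_, fun s => ?_⟩
    · rw [measure_union (disjoint_sdiff_right.mono_right inter_subset_left) hm, hr,
        add_tsub_cancel_of_le hle]
    · rw [← hr]
      exact volume_symmPart_union_le _ _ s

end SymmetricPart

section SymDelta

open Set

variable {ε δ a M : ℝ}

theorem le_symDelta (h0 : 0 ≤ ε) (h1 : ε ≤ 1) (hδ : 0 ≤ δ)
    (h : ∀ A : Set ℝ, A ⊆ Ico 0 1 → MeasurableSet A → volume A = ENNReal.ofReal ε →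
      ∃ s, ENNReal.ofReal δ ≤ volume (symmPart A s)) : δ ≤ symDelta ε := by
  refine le_csSup (guaranteedMeasures_nonempty_bddAbove ε h0 h1).2 ⟨hδ, fun A hA hAm hAv => ?_⟩
  obtain ⟨B, hBA, hBm, hBv⟩ := hAm.exists_measurable_subset_ae_eq
  obtain ⟨s, hs⟩ := h B (hBA.trans hA) hBm ((measure_congr hBv).trans hAv)
  have hsub : symmPart B s ⊆ A := inter_subset_left.trans hBA
  obtain ⟨r, hr⟩ := exists_volume_inter_closedBall_eq
    ((Metric.isBounded_Ico 0 1).subset (hsub.trans hA)) (s / 2) hs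
  exact ⟨_, inter_subset_left.trans hsub, isSymmetricSet_symmPart_inter_closedBall B s r,
    ((measurableSet_symmPart hBm).inter measurableSet_closedBall).nullMeasurableSet, hr⟩

theorem mul_sq_le_symDelta (h0 : 0 ≤ ε) (h1 : ε ≤ 1) : 0.609 * ε ^ 2 ≤ symDelta ε := by
  lift ε to ℝ≥0 using h0
  refine le_of_forall_lt_imp_le_of_dense fun δ hδ => ?_
  rcases lt_or_ge δ 0 with hneg | hδ0
  · exact hneg.le.trans (le_symDelta ε.coe_nonneg h1 le_rfl fun A _ _ _ => ⟨0, by simp⟩)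
  lift δ to ℝ≥0 using hδ0
  refine le_symDelta ε.coe_nonneg h1 δ.coe_nonneg fun A hA hAm hAv => ?_
  by_contra! hcon
  have hle : 0.609 * ε ^ 2 ≤ δ := by
    refine mul_sq_le_of_lconvolution_self_le (f := A.indicator 1) (measurable_one.indicator hAm)
      (support_indicator_subset.trans (hA.trans Ico_subset_Icc_self)) ?_ fun s => ?_
    · rw [lintegral_indicator_one hAm, hAv, ENNReal.ofReal_coe_nnreal]
    · rw [lconvolution_indicator_self hAm, ← ENNReal.ofReal_coe_nnreal]
      exact (hcon s).le
  exact absurd hδ (not_lt.2 (by exact_mod_cast hle))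

theorem two_mul_sub_one_le_symDelta (h0 : 1 / 2 ≤ ε) (h1 : ε ≤ 1) : 2 * ε - 1 ≤ symDelta ε := by
  refine le_symDelta (by linarith) h1 (by linarith) fun A hA hAm hAv => ⟨1, ?_⟩
  have hrefl : (fun x : ℝ => 1 - x) ⁻¹' A ⊆ Icc 0 1 := fun x hx => by
    have := hA hx
    grind
  have hunion : volume (A ∪ (fun x : ℝ => 1 - x) ⁻¹' A) ≤ 1 := by
    simpa using measure_mono (μ := volume) (union_subset (hA.trans Ico_subset_Icc_self) hrefl)
  calc ENNReal.ofReal (2 * ε - 1) = ENNReal.ofReal ε + ENNReal.ofReal ε - 1 := by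
        rw [← ENNReal.ofReal_add (by linarith) (by linarith), ← two_mul,
          ENNReal.ofReal_sub _ zero_le_one, ENNReal.ofReal_one]
    _ = volume (A ∪ (fun x => 1 - x) ⁻¹' A) + volume (symmPart A 1) - 1 := by
        rw [symmPart, measure_union_add_inter A (measurable_const_sub 1 hAm),
          volume_preimage_sub_left, hAv]
    _ ≤ volume (symmPart A 1) := by
        rw [tsub_le_iff_left]
        gcongr

theorem symDelta_le_of_volume_symmPart_le (h0 : 0 ≤ ε) (h1 : ε ≤ 1) (hM : 0 ≤ M) {A : Set ℝ}
    (hA : A ⊆ Ico 0 1) (hAm : MeasurableSet A) (hAv : volume A = ENNReal.ofReal ε)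
    (h : ∀ s, volume (symmPart A s) ≤ ENNReal.ofReal M) : symDelta ε ≤ M := by
  refine csSup_le (guaranteedMeasures_nonempty_bddAbove ε h0 h1).1 fun δ hδ => ?_
  obtain ⟨C, hCA, hC, -, hCv⟩ := hδ.2 A hA hAm.nullMeasurableSet hAv
  obtain ⟨s, hs⟩ := exists_subset_symmPart hC hCA
  rw [← ENNReal.ofReal_le_ofReal_iff hM, ← hCv]
  exact (measure_mono hs).trans (h s)

/-- Subsets of `[0, 1)` of measure at least `a - η` none of whose symmetric subsets has measure
more than `M + η` exist for all `η > 0`. -/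
def HasThinSets (a M : ℝ) : Prop :=
  ∀ η > 0, ∃ A ⊆ Ico (0 : ℝ) 1, MeasurableSet A ∧ ENNReal.ofReal (a - η) ≤ volume A ∧
    ∀ s, volume (symmPart A s) ≤ ENNReal.ofReal (M + η)

theorem HasThinSets.symDelta_le (h : HasThinSets a M) (hM : 0 ≤ M) (h0 : 0 ≤ ε) (ha : a ≤ ε)
    (h1 : ε ≤ 1) : symDelta ε ≤ M + 2 * (ε - a) := by
  refine le_of_forall_pos_le_add fun η hη => ?_
  obtain ⟨A, hA, hAm, hAv, hAs⟩ := h (η / 3) (by positivity)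
  obtain ⟨A', hA', hAm', hAv', hAs'⟩ := exists_volume_eq_and_symmPart_le hA hAm
    (ENNReal.ofReal_le_one.2 h1)
  have hdeficit : ENNReal.ofReal ε - volume A ≤ ENNReal.ofReal (ε - a + η / 3) := by
    rw [tsub_le_iff_right]
    calc ENNReal.ofReal ε = ENNReal.ofReal (ε - a + η / 3 + (a - η / 3)) := by ring_nf
      _ ≤ ENNReal.ofReal (ε - a + η / 3) + volume A :=
          ENNReal.ofReal_add_le.trans (by gcongr)
  refine symDelta_le_of_volume_symmPart_le h0 h1 (by linarith) hA' hAm' hAv' fun s => ?_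
  calc volume (symmPart A' s) ≤ volume (symmPart A s) + 2 * (ENNReal.ofReal ε - volume A) := hAs' s
    _ ≤ ENNReal.ofReal (M + η / 3) + 2 * ENNReal.ofReal (ε - a + η / 3) := by
        gcongr
        exact hAs s
    _ = ENNReal.ofReal (M + 2 * (ε - a) + η) := by
        rw [two_mul, ← ENNReal.ofReal_add (by linarith) (by linarith),
          ← ENNReal.ofReal_add (by linarith) (by linarith)]
        ring_nf

end SymDelta

section Rounding

open Finset Function

variable {ι J κ : Type*} [DecidableEq ι]

/-- A function of finitely or infinitely many real variables that is affine in each variable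
separately. -/
def CoordAffine (G : (ι → ℝ) → ℝ) : Prop :=
  ∀ (x : ι → ℝ) (i : ι), ∃ a b : ℝ, ∀ y, G (update x i y) = a + b * y

theorem CoordAffine.const_mul {G : (ι → ℝ) → ℝ} (h : CoordAffine G) (c : ℝ) :
    CoordAffine fun x => c * G x := fun x i => by
  obtain ⟨a, b, hab⟩ := h x i
  exact ⟨c * a, c * b, fun y => by simp only [hab]; ring⟩

theorem CoordAffine.sum {G : κ → (ι → ℝ) → ℝ} (K : Finset κ) (h : ∀ k ∈ K, CoordAffine (G k)) :
    CoordAffine fun x => ∑ k ∈ K, G k x := fun x i => by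
  choose! a b hab using fun k hk => h k hk x i
  refine ⟨∑ k ∈ K, a k, ∑ k ∈ K, b k, fun y => ?_⟩
  rw [sum_mul, ← sum_add_distrib]
  exact sum_congr rfl fun k hk => hab k hk y

theorem coordAffine_prod_one_add_mul_prod (c : ℝ) {s : Finset J} {V : J → Finset ι}
    (hV : (s : Set J).PairwiseDisjoint V) :
    CoordAffine fun x => ∏ j ∈ s, (1 + c * ∏ i ∈ V j, x i) := fun x i => by
  classical
  by_cases h : ∃ j ∈ s, i ∈ V j
  · obtain ⟨j, hj, hij⟩ := h
    set P := ∏ j' ∈ s.erase j, (1 + c * ∏ i ∈ V j', x i)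
    refine ⟨P, c * (∏ i' ∈ V j \ {i}, x i') * P, fun y => ?_⟩
    have hrest : ∏ j' ∈ s.erase j, (1 + c * ∏ i' ∈ V j', update x i y i') = P :=
      prod_congr rfl fun j' hj' => by
        have hi : i ∉ V j' := disjoint_left.1
          (hV hj (mem_of_mem_erase hj') (ne_of_mem_erase hj').symm) hij
        rw [prod_update_of_notMem hi]
    beta_reduce
    rw [← mul_prod_erase s _ hj, hrest, prod_update_of_mem hij]
    ring
  · push Not at h
    refine ⟨∏ j ∈ s, (1 + c * ∏ i ∈ V j, x i), 0, fun y => ?_⟩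
    rw [zero_mul, add_zero]
    exact prod_congr rfl fun j hj => by rw [prod_update_of_notMem (h j hj)]

theorem CoordAffine.exists_update_le {G : (ι → ℝ) → ℝ} (hG : CoordAffine G) {x : ι → ℝ} {i : ι}
    (h0 : 0 ≤ x i) (h1 : x i ≤ 1) : ∃ z : ℝ, (z = 0 ∨ z = 1) ∧ G (update x i z) ≤ G x := by
  obtain ⟨a, b, hab⟩ := hG x i
  have hself : G x = a + b * x i := by rw [← hab, update_eq_self]
  rcases le_total 0 b with hb | hb
  · exact ⟨0, .inl rfl, by rw [hab, hself]; nlinarith⟩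
  · exact ⟨1, .inr rfl, by rw [hab, hself]; nlinarith⟩

theorem CoordAffine.exists_rounding {G : (ι → ℝ) → ℝ} (hG : CoordAffine G) {p : ι → ℝ}
    (h0 : ∀ i, 0 ≤ p i) (h1 : ∀ i, p i ≤ 1) (T : Finset ι) :
    ∃ x : ι → ℝ, (∀ i ∈ T, x i = 0 ∨ x i = 1) ∧ (∀ i ∉ T, x i = p i) ∧ G x ≤ G p := by
  induction T using Finset.induction_on with
  | empty => exact ⟨p, by simp, by simp, le_rfl⟩
  | insert i T hi ih =>
    obtain ⟨x, hx, hxp, hle⟩ := ih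
    obtain ⟨z, hz, hzle⟩ := hG.exists_update_le (x := x) (i := i) (by rw [hxp i hi]; exact h0 i)
      (by rw [hxp i hi]; exact h1 i)
    refine ⟨update x i z, fun j hj => ?_, fun j hj => ?_, hzle.trans hle⟩
    · rcases eq_or_ne j i with rfl | hne
      · rwa [update_self]
      · rw [update_of_ne hne]
        exact hx j (mem_of_mem_insert_of_ne hj hne)
    · rw [mem_insert, not_or] at hj
      rw [update_of_ne hj.1, hxp j hj.2]

theorem CoordAffine.exists_indicator_le {G : (ι → ℝ) → ℝ} (hG : CoordAffine G) {p : ι → ℝ}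
    (h0 : ∀ i, 0 ≤ p i) (h1 : ∀ i, p i ≤ 1) {T : Finset ι} (hT : ∀ i ∉ T, p i = 0) :
    ∃ S ⊆ T, G ((S : Set ι).indicator 1) ≤ G p := by
  obtain ⟨x, hx, hxp, hle⟩ := hG.exists_rounding h0 h1 T
  have heq : ((T.filter fun i => x i = 1 : Finset ι) : Set ι).indicator 1 = x := by
    ext i
    by_cases hi : i ∈ T
    · rcases hx i hi with h | h <;> simp [h, hi]
    · simp [hi, hxp i hi, hT i hi]
  exact ⟨T.filter fun i => x i = 1, filter_subset _ _, by rwa [heq]⟩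

end Rounding

section Chernoff

open Finset

variable {ι J κ : Type*}

theorem prod_one_add_exp_sub_one_mul {s : Finset J} {q : J → ℝ} (hq : ∀ j ∈ s, q j = 0 ∨ q j = 1)
    (t : ℝ) : ∏ j ∈ s, (1 + (Real.exp t - 1) * q j) = Real.exp (t * ∑ j ∈ s, q j) := by
  rw [mul_sum, Real.exp_sum]
  exact prod_congr rfl fun j hj => by rcases hq j hj with h | h <;> simp [h]

theorem one_add_exp_sub_one_mul_le {q t : ℝ} (h0 : 0 ≤ q) (h1 : q ≤ 1) (ht : |t| ≤ 1) :
    1 + (Real.exp t - 1) * q ≤ Real.exp (t * q + t ^ 2) := by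
  have hexp : Real.exp t - 1 ≤ t + t ^ 2 := by
    linarith [(abs_le.1 (Real.abs_exp_sub_one_sub_id_le ht)).2]
  calc 1 + (Real.exp t - 1) * q ≤ t * q + t ^ 2 + 1 := by
        nlinarith [mul_le_mul_of_nonneg_right hexp h0, mul_le_mul_of_nonneg_left h1 (sq_nonneg t)]
    _ ≤ Real.exp (t * q + t ^ 2) := Real.add_one_le_exp _

theorem prod_one_add_exp_sub_one_mul_le {s : Finset J} {q : J → ℝ} (h0 : ∀ j ∈ s, 0 ≤ q j)
    (h1 : ∀ j ∈ s, q j ≤ 1) {t : ℝ} (ht : |t| ≤ 1) :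
    ∏ j ∈ s, (1 + (Real.exp t - 1) * q j) ≤ Real.exp (t * ∑ j ∈ s, q j + t ^ 2 * #s) := by
  have hsum : t * ∑ j ∈ s, q j + t ^ 2 * #s = ∑ j ∈ s, (t * q j + t ^ 2) := by
    rw [sum_add_distrib, mul_sum, sum_const, nsmul_eq_mul, mul_comm (t ^ 2)]
  rw [hsum, Real.exp_sum]
  refine prod_le_prod (fun j hj => ?_) fun j hj => one_add_exp_sub_one_mul_le (h0 j hj) (h1 j hj) ht
  nlinarith [mul_nonneg (Real.exp_pos t).le (h0 j hj), h1 j hj]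

theorem exp_neg_mul_prod_one_add_exp_sub_one_mul_le {s : Finset J} {q : J → ℝ}
    (h0 : ∀ j ∈ s, 0 ≤ q j) (h1 : ∀ j ∈ s, q j ≤ 1) {t w n : ℝ} (ht0 : 0 ≤ t) (ht1 : t ≤ 1)
    (hw : |w| ≤ 1) (hn : #s ≤ n) :
    Real.exp (-(t * w * ∑ j ∈ s, q j)) * ∏ j ∈ s, (1 + (Real.exp (t * w) - 1) * q j) ≤
      Real.exp (t ^ 2 * n) := by
  have htw : |t * w| ≤ 1 := by
    rw [abs_mul, abs_of_nonneg ht0]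
    exact mul_le_one₀ ht1 (abs_nonneg _) hw
  refine (mul_le_mul_of_nonneg_left (prod_one_add_exp_sub_one_mul_le h0 h1 htw)
    (Real.exp_pos _).le).trans ?_
  rw [← Real.exp_add, neg_add_cancel_left, Real.exp_le_exp, mul_pow]
  gcongr
  exact mul_le_of_le_one_right (sq_nonneg t) ((sq_le_one_iff_abs_le_one _).2 hw)

theorem prod_indicator_one_eq_zero_or_one (s : Finset ι) (S : Set ι) :
    ∏ i ∈ s, S.indicator (1 : ι → ℝ) i = 0 ∨ ∏ i ∈ s, S.indicator (1 : ι → ℝ) i = 1 := by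
  by_cases h : ∀ i ∈ s, i ∈ S
  · exact .inr (prod_eq_one fun i hi => by simp [h i hi])
  · push Not at h
    obtain ⟨i, hi, hiS⟩ := h
    exact .inl (prod_eq_zero hi (by simp [hiS]))

theorem le_of_exp_mul_le {t u m n : ℝ} (ht : 0 < t) (hm : 0 < m)
    (h : Real.exp (t * u) ≤ m * Real.exp (t ^ 2 * n)) : u ≤ t * n + Real.log m / t := by
  have hlog := Real.log_le_log (Real.exp_pos _) h
  rw [Real.log_exp, Real.log_mul hm.ne' (Real.exp_pos _).ne', Real.log_exp] at hlog
  have heq : t * n + Real.log m / t = (Real.log m + t ^ 2 * n) / t := by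
    field_simp
    ring
  rwa [heq, le_div_iff₀ ht, mul_comm]

/-- The method of conditional expectations for the exponential moments
`∑ k, exp (t * w k * (Z k x - Z k p))`, where `Z k x = ∑ j ∈ s k, ∏ i ∈ V j, x i`. -/
theorem exists_indicator_forall_mul_sub_le {K : Finset κ} {w : κ → ℝ}
    (hw : ∀ k ∈ K, |w k| ≤ 1) {s : κ → Finset J} {V : J → Finset ι}
    (hV : ∀ k ∈ K, (s k : Set J).PairwiseDisjoint V) {n : ℝ} (hn : ∀ k ∈ K, #(s k) ≤ n)
    {p : ι → ℝ} (h0 : ∀ i, 0 ≤ p i) (h1 : ∀ i, p i ≤ 1) {T : Finset ι} (hT : ∀ i ∉ T, p i = 0)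
    {t : ℝ} (ht0 : 0 < t) (ht1 : t ≤ 1) :
    ∃ S ⊆ T, ∀ k ∈ K,
      w k * (∑ j ∈ s k, ∏ i ∈ V j, (S : Set ι).indicator 1 i - ∑ j ∈ s k, ∏ i ∈ V j, p i) ≤
        t * n + Real.log #K / t := by
  classical
  set Z : κ → (ι → ℝ) → ℝ := fun k x => ∑ j ∈ s k, ∏ i ∈ V j, x i
  set G : κ → (ι → ℝ) → ℝ := fun k x => Real.exp (-(t * w k * Z k p)) *
    ∏ j ∈ s k, (1 + (Real.exp (t * w k) - 1) * ∏ i ∈ V j, x i) with hG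
  obtain ⟨S, hST, hle⟩ := (CoordAffine.sum K fun k hk =>
    (coordAffine_prod_one_add_mul_prod (Real.exp (t * w k) - 1) (hV k hk)).const_mul
      (Real.exp (-(t * w k * Z k p)))).exists_indicator_le h0 h1 hT
  refine ⟨S, hST, fun k hk => ?_⟩
  have hexp (k : κ) : G k ((S : Set ι).indicator 1) =
      Real.exp (t * (w k * (Z k ((S : Set ι).indicator 1) - Z k p))) := by
    simp only [hG]
    rw [prod_one_add_exp_sub_one_mul fun j _ => prod_indicator_one_eq_zero_or_one (V j) S,
      ← Real.exp_add]
    congr 1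
    ring
  have hbound : ∀ k ∈ K, G k p ≤ Real.exp (t ^ 2 * n) := fun k hk =>
    exp_neg_mul_prod_one_add_exp_sub_one_mul_le (fun j _ => prod_nonneg fun i _ => h0 i)
      (fun j _ => prod_le_one (fun i _ => h0 i) fun i _ => h1 i) ht0.le ht1 (hw k hk) (hn k hk)
  refine le_of_exp_mul_le ht0 (by exact_mod_cast card_pos.2 ⟨k, hk⟩) ?_
  calc Real.exp (t * (w k * (Z k ((S : Set ι).indicator 1) - Z k p)))
      = G k ((S : Set ι).indicator 1) := (hexp k).symm
    _ ≤ ∑ k ∈ K, G k ((S : Set ι).indicator 1) :=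
        single_le_sum (f := fun k => G k ((S : Set ι).indicator 1))
          (fun j _ => by rw [hexp]; positivity) hk
    _ ≤ ∑ k ∈ K, G k p := hle
    _ ≤ #K * Real.exp (t ^ 2 * n) := by
        rw [← nsmul_eq_mul]
        exact sum_le_card_nsmul _ _ _ hbound

end Chernoff

section SelfConvolution

open Finset

/-- The additive self-convolution `∑ i + j = k, x i * x j` of a sequence. -/
def selfConv (x : ℕ → ℝ) (k : ℕ) : ℝ := ∑ ij ∈ antidiagonal k, x ij.1 * x ij.2

/-- The pairs `i < j` with `i + j = k`. -/
def strictPairs (k : ℕ) : Finset (ℕ × ℕ) := {ij ∈ antidiagonal k | ij.1 < ij.2}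

theorem selfConv_eq_two_mul_add (x : ℕ → ℝ) (k : ℕ) :
    selfConv x k = 2 * ∑ ij ∈ strictPairs k, x ij.1 * x ij.2 +
      ∑ ij ∈ antidiagonal k with ij.1 = ij.2, x ij.1 * x ij.2 := by
  have hswap : ∑ ij ∈ antidiagonal k with ij.2 < ij.1, x ij.1 * x ij.2 =
      ∑ ij ∈ strictPairs k, x ij.1 * x ij.2 :=
    sum_nbij' Prod.swap Prod.swap (by simp [strictPairs, add_comm])
      (by simp [strictPairs, add_comm]) (by simp) (by simp) fun ij _ => mul_comm _ _
  have hge : ∑ ij ∈ antidiagonal k with ¬ ij.1 < ij.2, x ij.1 * x ij.2 =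
      ∑ ij ∈ antidiagonal k with ij.1 = ij.2, x ij.1 * x ij.2 +
        ∑ ij ∈ antidiagonal k with ij.2 < ij.1, x ij.1 * x ij.2 := by
    simp only [sum_filter, ← sum_add_distrib]
    refine sum_congr rfl fun ij _ => ?_
    rcases lt_trichotomy ij.1 ij.2 with h | h | h
    · simp [h, h.ne, h.not_gt]
    · simp [h]
    · simp [h, h.ne', h.not_gt]
  rw [selfConv, ← sum_filter_add_sum_filter_not _ fun ij : ℕ × ℕ => ij.1 < ij.2, hge, hswap,
    strictPairs]
  ring

theorem sum_antidiagonal_diag_le_one {x : ℕ → ℝ} (h0 : ∀ i, 0 ≤ x i) (h1 : ∀ i, x i ≤ 1) (k : ℕ) :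
    ∑ ij ∈ antidiagonal k with ij.1 = ij.2, x ij.1 * x ij.2 ≤ 1 := by
  have hcard : #{ij ∈ antidiagonal k | ij.1 = ij.2} ≤ 1 := card_le_one.2 fun a ha b hb => by
    simp only [mem_filter, HasAntidiagonal.mem_antidiagonal] at ha hb
    ext <;> omega
  calc ∑ ij ∈ antidiagonal k with ij.1 = ij.2, x ij.1 * x ij.2
      ≤ #{ij ∈ antidiagonal k | ij.1 = ij.2} • (1 : ℝ) :=
        sum_le_card_nsmul _ _ _ fun ij _ => mul_le_one₀ (h1 _) (h0 _) (h1 _)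
    _ ≤ 1 := by simpa using hcard

theorem card_strictPairs_le (k : ℕ) : #(strictPairs k) ≤ k + 1 :=
  (card_filter_le _ _).trans_eq (Nat.card_antidiagonal k)

theorem pairwiseDisjoint_strictPairs (k : ℕ) :
    (strictPairs k : Set (ℕ × ℕ)).PairwiseDisjoint fun ij => ({ij.1, ij.2} : Finset ℕ) := by
  rintro ⟨i, j⟩ hij ⟨i', j'⟩ hij' hne
  simp only [strictPairs, coe_filter, HasAntidiagonal.mem_antidiagonal,
    Set.mem_ofPred_eq] at hij hij'
  rw [ne_eq, Prod.mk.injEq] at hne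
  simp only [Function.onFun, disjoint_left, mem_insert, mem_singleton]
  omega

theorem sum_strictPairs_prod (x : ℕ → ℝ) (k : ℕ) :
    ∑ ij ∈ strictPairs k, ∏ i ∈ {ij.1, ij.2}, x i = ∑ ij ∈ strictPairs k, x ij.1 * x ij.2 :=
  sum_congr rfl fun _ hij => prod_pair (mem_filter.1 hij).2.ne

theorem pairwiseDisjoint_diag (s : Finset ℕ) :
    (s.diag : Set (ℕ × ℕ)).PairwiseDisjoint fun ij => ({ij.1, ij.2} : Finset ℕ) := by
  rintro ⟨i, j⟩ hij ⟨i', j'⟩ hij' hne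
  rw [mem_coe, mem_diag] at hij hij'
  rw [ne_eq, Prod.mk.injEq] at hne
  simp only [Function.onFun, disjoint_left, mem_insert, mem_singleton]
  omega

theorem sum_diag_prod (x : ℕ → ℝ) (s : Finset ℕ) :
    ∑ ij ∈ s.diag, ∏ i ∈ {ij.1, ij.2}, x i = ∑ i ∈ s, x i := by
  simp [sum_diag]

theorem exists_subset_range_rounding {N : ℕ} {p : ℕ → ℝ} (h0 : ∀ i, 0 ≤ p i) (h1 : ∀ i, p i ≤ 1)
    (hp : ∀ i, N ≤ i → p i = 0) {t : ℝ} (ht0 : 0 < t) (ht1 : t ≤ 1) :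
    ∃ S ⊆ range N, ∑ i ∈ range N, p i ≤ #S + (t * (2 * N) + Real.log (2 * N + 1) / t) ∧
      ∀ k < 2 * N,
        ∑ ij ∈ strictPairs k, (S : Set ℕ).indicator 1 ij.1 * (S : Set ℕ).indicator 1 ij.2 ≤
          ∑ ij ∈ strictPairs k, p ij.1 * p ij.2 + (t * (2 * N) + Real.log (2 * N + 1) / t) := by
  have hcard (k : ℕ) (hk : k ∈ range (2 * N)) : (#(strictPairs k) : ℝ) ≤ 2 * N := by
    exact_mod_cast (card_strictPairs_le k).trans (mem_range.1 hk)
  obtain ⟨S, hSN, hS⟩ := exists_indicator_forall_mul_sub_le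
    (K := insertNone (range (2 * N))) (w := fun k => k.elim (-1) fun _ => 1)
    (s := fun k => k.elim (range N).diag strictPairs) (V := fun ij => {ij.1, ij.2}) (n := 2 * N)
    (by simp [Option.forall])
    (forall_mem_insertNone.2 ⟨pairwiseDisjoint_diag _, fun k _ => pairwiseDisjoint_strictPairs k⟩)
    (forall_mem_insertNone.2 ⟨by simp [two_mul], hcard⟩)
    h0 h1 (T := range N) (fun i hi => hp i (by simpa using hi)) ht0 ht1
  simp only [forall_mem_insertNone, Option.elim_none, Option.elim_some, sum_diag_prod,
    sum_strictPairs_prod, card_insertNone, card_range] at hS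
  push_cast at hS
  refine ⟨S, hSN, ?_, fun k hk => by linarith [hS.2 k (mem_range.2 hk)]⟩
  have hcardS : ∑ i ∈ range N, (S : Set ℕ).indicator (1 : ℕ → ℝ) i = #S := by
    rw [sum_indicator_subset _ hSN]
    simp
  linarith [hS.1]

theorem exists_subset_range_selfConv_le {N : ℕ} {p : ℕ → ℝ} (h0 : ∀ i, 0 ≤ p i)
    (h1 : ∀ i, p i ≤ 1) (hp : ∀ i, N ≤ i → p i = 0) {t : ℝ} (ht0 : 0 < t) (ht1 : t ≤ 1) :
    ∃ S ⊆ range N, ∑ i ∈ range N, p i ≤ #S + (t * (2 * N) + Real.log (2 * N + 1) / t) ∧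
      ∀ k < 2 * N, selfConv ((S : Set ℕ).indicator 1) k ≤
        selfConv p k + 2 * (t * (2 * N) + Real.log (2 * N + 1) / t) + 1 := by
  obtain ⟨S, hSN, hsum, hpairs⟩ := exists_subset_range_rounding h0 h1 hp ht0 ht1
  refine ⟨S, hSN, hsum, fun k hk => ?_⟩
  have hdiagS := sum_antidiagonal_diag_le_one (x := (S : Set ℕ).indicator 1)
    (fun i => Set.indicator_nonneg (fun _ _ => zero_le_one) i)
    (fun i => Set.indicator_le_self' (fun _ _ => zero_le_one) i) k
  have hdiag : 0 ≤ ∑ ij ∈ antidiagonal k with ij.1 = ij.2, p ij.1 * p ij.2 :=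
    sum_nonneg fun ij _ => mul_nonneg (h0 _) (h0 _)
  rw [selfConv_eq_two_mul_add, selfConv_eq_two_mul_add p]
  linarith [hpairs k hk]

theorem selfConv_indicator_one (S : Finset ℕ) (k : ℕ) :
    selfConv ((S : Set ℕ).indicator 1) k = #{ij ∈ S ×ˢ S | ij.1 + ij.2 = k} := by
  have hfilter : {ij ∈ S ×ˢ S | ij.1 + ij.2 = k} =
      {ij ∈ antidiagonal k | ij.1 ∈ S ∧ ij.2 ∈ S} := by
    ext
    simp [and_comm]
  rw [hfilter, card_filter, Nat.cast_sum]
  refine sum_congr rfl fun ij _ => ?_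
  by_cases hi : ij.1 ∈ S <;> by_cases hj : ij.2 ∈ S <;> simp [hi, hj]

end SelfConvolution

section Cells

open Set

/-- The `i`-th of the consecutive half-open intervals of length `h` starting at `0`. -/
def cell (h : ℝ) (i : ℕ) : Set ℝ := Ico (i * h) ((i + 1 : ℕ) * h)

variable {h : ℝ}

theorem pairwise_disjoint_cell (hh : 0 ≤ h) : Pairwise (Function.onFun Disjoint (cell h)) :=
  Monotone.pairwise_disjoint_on_Ico_succ (f := fun i : ℕ => i * h) fun i j hij => by
    beta_reduce
    gcongr

theorem volume_cell (h : ℝ) (i : ℕ) : volume (cell h i) = ENNReal.ofReal h := by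
  rw [cell, Real.volume_Ico]
  congr 1
  push_cast
  ring

theorem measurableSet_cell (h : ℝ) (i : ℕ) : MeasurableSet (cell h i) := measurableSet_Ico

theorem volume_biUnion_cell (hh : 0 ≤ h) (S : Finset ℕ) :
    volume (⋃ i ∈ S, cell h i) = S.card * ENNReal.ofReal h := by
  rw [measure_biUnion_finset ((pairwise_disjoint_cell hh).set_pairwise _)
    fun i _ => measurableSet_cell h i]
  simp [volume_cell]

theorem volume_cell_inter_preimage_cell (h s : ℝ) (i j : ℕ) :
    volume (cell h i ∩ (fun x => s - x) ⁻¹' cell h j) =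
      volume (cell h 0 ∩ (fun x => s - x) ⁻¹' cell h (i + j)) := by
  rw [← measure_preimage_add_right volume (i * h)]
  congr 1
  ext x
  simp only [cell, mem_preimage, mem_inter_iff, mem_Ico]
  push_cast
  constructor <;> rintro ⟨⟨_, _⟩, _, _⟩ <;> refine ⟨⟨?_, ?_⟩, ?_, ?_⟩ <;> linarith

theorem sum_volume_cell_inter_preimage_cell_le (hh : 0 ≤ h) (s : ℝ) (K : Finset ℕ) :
    ∑ k ∈ K, volume (cell h 0 ∩ (fun x => s - x) ⁻¹' cell h k) ≤ ENNReal.ofReal h := by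
  rw [← measure_biUnion_finset
    (fun i _ j _ hij => (((pairwise_disjoint_cell hh) hij).preimage _).mono
      inter_subset_right inter_subset_right)
    fun k _ => (measurableSet_cell h 0).inter (measurable_const_sub s (measurableSet_cell h k)),
    ← volume_cell h 0]
  exact measure_mono (iUnion₂_subset fun _ _ => inter_subset_left)

theorem volume_symmPart_biUnion_cell_le_sum (h : ℝ) (S : Finset ℕ) (s : ℝ) :
    volume (symmPart (⋃ i ∈ S, cell h i) s) ≤
      ∑ ij ∈ S ×ˢ S, volume (cell h 0 ∩ (fun x => s - x) ⁻¹' cell h (ij.1 + ij.2)) := by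
  have hcover : symmPart (⋃ i ∈ S, cell h i) s ⊆
      ⋃ ij ∈ S ×ˢ S, cell h ij.1 ∩ (fun x => s - x) ⁻¹' cell h ij.2 := by
    rintro x ⟨hx, hsx⟩
    obtain ⟨i, hi, hxi⟩ := mem_iUnion₂.1 hx
    obtain ⟨j, hj, hsxj⟩ := mem_iUnion₂.1 hsx
    exact mem_iUnion₂.2 ⟨(i, j), Finset.mem_product.2 ⟨hi, hj⟩, hxi, hsxj⟩
  refine (measure_mono hcover).trans ((measure_biUnion_finset_le _ _).trans_eq ?_)
  exact Finset.sum_congr rfl fun ij _ => volume_cell_inter_preimage_cell h s ij.1 ij.2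

theorem volume_symmPart_biUnion_cell_le (hh : 0 ≤ h) {S : Finset ℕ} {N : ℕ}
    (hS : S ⊆ Finset.range N) {R : ℝ}
    (hR : ∀ k < 2 * N, selfConv ((S : Set ℕ).indicator 1) k ≤ R) (s : ℝ) :
    volume (symmPart (⋃ i ∈ S, cell h i) s) ≤ ENNReal.ofReal (R * h) := by
  set v : ℕ → ℝ≥0∞ := fun k => volume (cell h 0 ∩ (fun x => s - x) ⁻¹' cell h k)
  have hmaps : ∀ ij ∈ S ×ˢ S, ij.1 + ij.2 ∈ Finset.range (2 * N) := fun ij hij => by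
    have hi := Finset.mem_range.1 (hS (Finset.mem_product.1 hij).1)
    have hj := Finset.mem_range.1 (hS (Finset.mem_product.1 hij).2)
    exact Finset.mem_range.2 (by omega)
  calc volume (symmPart (⋃ i ∈ S, cell h i) s)
      ≤ ∑ ij ∈ S ×ˢ S, v (ij.1 + ij.2) := volume_symmPart_biUnion_cell_le_sum h S s
    _ = ∑ k ∈ Finset.range (2 * N), ({ij ∈ S ×ˢ S | ij.1 + ij.2 = k} : Finset _).card * v k := by
        rw [← Finset.sum_fiberwise_of_maps_to hmaps]
        refine Finset.sum_congr rfl fun k _ => ?_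
        rw [← nsmul_eq_mul]
        exact Finset.sum_eq_card_nsmul fun ij hij => by rw [(Finset.mem_filter.1 hij).2]
    _ ≤ ∑ k ∈ Finset.range (2 * N), ENNReal.ofReal R * v k := by
        refine Finset.sum_le_sum fun k hk => mul_le_mul_left ?_ _
        rw [← ENNReal.ofReal_natCast, ← selfConv_indicator_one]
        exact ENNReal.ofReal_le_ofReal (hR k (Finset.mem_range.1 hk))
    _ ≤ ENNReal.ofReal (R * h) := by
        rw [← Finset.mul_sum, ENNReal.ofReal_mul' hh]
        gcongr
        exact sum_volume_cell_inter_preimage_cell_le hh s _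

theorem biUnion_cell_subset_Ico {N : ℕ} (hh : 0 ≤ h) (hN : N * h ≤ 1) {S : Finset ℕ}
    (hS : S ⊆ Finset.range N) : ⋃ i ∈ S, cell h i ⊆ Ico 0 1 :=
  iUnion₂_subset fun i hi => Ico_subset_Ico (by positivity)
    (hN.trans' (by gcongr; exact Finset.mem_range.1 (hS hi)))

theorem eventually_log_div_le {t : ℝ} (ht : 0 < t) :
    ∀ᶠ N : ℕ in Filter.atTop, Real.log (2 * N + 1) / t ≤ t * N := by
  have hlog : ∀ᶠ x : ℝ in Filter.atTop, Real.log x ≤ t ^ 2 / 4 * x := by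
    filter_upwards [Real.isLittleO_log_id_atTop.bound (show 0 < t ^ 2 / 4 by positivity),
      Filter.eventually_ge_atTop 0] with x hx hx0
    rw [id, Real.norm_of_nonneg hx0] at hx
    exact (Real.le_norm_self _).trans hx
  have htendsto : Filter.Tendsto (fun N : ℕ => 2 * (N : ℝ) + 1) Filter.atTop Filter.atTop :=
    Filter.tendsto_atTop_add_const_right _ _
      (tendsto_natCast_atTop_atTop.const_mul_atTop two_pos)
  filter_upwards [htendsto.eventually hlog, Filter.eventually_ge_atTop 1] with N hN hN1
  have hN1' : (1 : ℝ) ≤ N := mod_cast hN1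
  rw [div_le_iff₀ ht]
  nlinarith [sq_nonneg t]

theorem hasThinSets_of_densities {a M : ℝ}
    (hd : ∀ η > 0, ∃ᶠ N : ℕ in Filter.atTop, ∃ p : ℕ → ℝ, (∀ i, 0 ≤ p i) ∧ (∀ i, p i ≤ 1) ∧
      (∀ i, N ≤ i → p i = 0) ∧ (a - η) * N ≤ ∑ i ∈ Finset.range N, p i ∧
      ∀ k, selfConv p k ≤ (M + η) * N) :
    HasThinSets a M := by
  intro η hη
  obtain ⟨t, ht0, ht1, htη⟩ : ∃ t : ℝ, 0 < t ∧ t ≤ 1 ∧ 8 * t ≤ η :=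
    ⟨min 1 (η / 8), by positivity, min_le_left _ _, by linarith [min_le_right 1 (η / 8)]⟩
  have hlarge : ∀ᶠ N : ℕ in Filter.atTop, 1 ≤ t * (N : ℝ) :=
    (tendsto_natCast_atTop_atTop.const_mul_atTop ht0).eventually_ge_atTop 1
  obtain ⟨N, ⟨p, h0, h1, hpN, hsum, hconv⟩, hlog, htN⟩ :=
    ((hd t ht0).and_eventually ((eventually_log_div_le ht0).and hlarge)).exists
  obtain ⟨S, hSN, hcard, hselfConv⟩ := exists_subset_range_selfConv_le h0 h1 hpN ht0 ht1
  have hN : (0 : ℝ) < N := pos_of_mul_pos_right (one_pos.trans_le htN) ht0.le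
  have hh : (0 : ℝ) ≤ 1 / N := by positivity
  refine ⟨⋃ i ∈ S, cell (1 / N) i, biUnion_cell_subset_Ico hh (mul_one_div_cancel hN.ne').le hSN,
    S.measurableSet_biUnion fun i _ => measurableSet_cell _ i, ?_, fun s => ?_⟩
  · rw [volume_biUnion_cell hh, ← ENNReal.ofReal_natCast, ← ENNReal.ofReal_mul (by positivity)]
    refine ENNReal.ofReal_le_ofReal ?_
    rw [mul_one_div, le_div_iff₀ hN]
    nlinarith
  · have hR (k : ℕ) (hk : k < 2 * N) :
        selfConv ((S : Set ℕ).indicator 1) k ≤ (M + η) * N := by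
      nlinarith [hselfConv k hk, hconv k]
    refine (volume_symmPart_biUnion_cell_le hh hSN hR s).trans_eq ?_
    rw [mul_assoc, mul_one_div_cancel hN.ne', mul_one]

end Cells

section Blocks

open Finset

variable {q : ℕ → ℝ} {C : ℝ} {m n : ℕ}

theorem sum_range_mul_comp_div (q : ℕ → ℝ) (hm : 0 < m) (n : ℕ) :
    ∑ i ∈ range (n * m), q (i / m) = m * ∑ a ∈ range n, q a := by
  induction n with
  | zero => simp
  | succ n ih =>
    have hblock : ∑ r ∈ range m, q ((n * m + r) / m) = m * q n := by
      rw [sum_congr rfl fun r hr => by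
        rw [mul_comm, Nat.mul_add_div hm, Nat.div_eq_of_lt (mem_range.1 hr), add_zero]]
      simp
    rw [add_mul, one_mul, sum_range_add, ih, hblock, sum_range_succ, mul_add]

theorem selfConv_const_mul (c : ℝ) (x : ℕ → ℝ) (k : ℕ) :
    selfConv (fun i => c * x i) k = c ^ 2 * selfConv x k := by
  rw [selfConv, selfConv, mul_sum]
  exact sum_congr rfl fun ij _ => by ring

theorem sum_antidiagonal_filter_mod_le_selfConv (hq : ∀ a, 0 ≤ q a) (hm : 0 < m) (k r : ℕ) :
    ∑ ij ∈ antidiagonal k with ij.1 % m = r, q (ij.1 / m) * q (ij.2 / m) ≤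
      selfConv q ((k - r) / m) := by
  have hinj : Set.InjOn (fun ij : ℕ × ℕ => (ij.1 / m, ij.2 / m))
      ({ij ∈ antidiagonal k | ij.1 % m = r} : Finset (ℕ × ℕ)) := by
    rintro ⟨i, j⟩ hij ⟨i', j'⟩ hij' heq
    simp only [coe_filter, HasAntidiagonal.mem_antidiagonal, Set.mem_ofPred_eq] at hij hij'
    have hi : i = i' := by
      rw [← Nat.div_add_mod i m, ← Nat.div_add_mod i' m, hij.2, hij'.2, (Prod.mk.inj heq).1]
    exact Prod.ext hi (by omega)
  rw [selfConv, ← sum_image (f := fun ab : ℕ × ℕ => q ab.1 * q ab.2) hinj]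
  refine sum_le_sum_of_subset_of_nonneg (fun ab hab => ?_) fun _ _ _ => mul_nonneg (hq _) (hq _)
  obtain ⟨⟨i, j⟩, hij, rfl⟩ := mem_image.1 hab
  simp only [mem_filter, HasAntidiagonal.mem_antidiagonal] at hij ⊢
  have hk : k - r = j + m * (i / m) := by
    have := Nat.div_add_mod i m
    omega
  rw [hk, Nat.add_mul_div_left _ _ hm, add_comm]

theorem selfConv_comp_div_le (hq : ∀ a, 0 ≤ q a) (hC : ∀ k, selfConv q k ≤ C) (hm : 0 < m)
    (k : ℕ) : selfConv (fun i => q (i / m)) k ≤ m * C :=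
  calc selfConv (fun i => q (i / m)) k
      = ∑ r ∈ range m, ∑ ij ∈ antidiagonal k with ij.1 % m = r, q (ij.1 / m) * q (ij.2 / m) :=
        (sum_fiberwise_of_maps_to (fun _ _ => mem_range.2 (Nat.mod_lt _ hm)) _).symm
    _ ≤ ∑ _r ∈ range m, C := sum_le_sum fun r _ =>
        (sum_antidiagonal_filter_mod_le_selfConv hq hm k r).trans (hC _)
    _ = m * C := by simp

theorem hasThinSets_of_blocks (hn : 0 < n) (h0 : ∀ a, 0 ≤ q a) (h1 : ∀ a, q a ≤ 1)
    (hq : ∀ a, n ≤ a → q a = 0) (hC : ∀ k, selfConv q k ≤ C) :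
    HasThinSets ((∑ a ∈ range n, q a) / n) (C / n) := by
  have : (0 : ℝ) < n := mod_cast hn
  refine hasThinSets_of_densities fun η hη => Filter.frequently_atTop.2 fun N₀ => ?_
  have hm : 0 < N₀ + 1 := N₀.succ_pos
  refine ⟨n * (N₀ + 1), by nlinarith, fun i => q (i / (N₀ + 1)), fun _ => h0 _, fun _ => h1 _,
    fun i hi => hq _ ((Nat.le_div_iff_mul_le hm).2 hi), ?_, fun k => ?_⟩
  · rw [sum_range_mul_comp_div q hm, Nat.cast_mul]
    have hslack : 0 ≤ η * (n * (N₀ + 1 : ℕ)) := by positivity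
    calc ((∑ a ∈ range n, q a) / n - η) * (n * (N₀ + 1 : ℕ))
        = (N₀ + 1 : ℕ) * ∑ a ∈ range n, q a - η * (n * (N₀ + 1 : ℕ)) := by field_simp
      _ ≤ (N₀ + 1 : ℕ) * ∑ a ∈ range n, q a := by linarith
  · rw [Nat.cast_mul]
    have hslack : 0 ≤ η * (n * (N₀ + 1 : ℕ)) := by positivity
    calc selfConv (fun i => q (i / (N₀ + 1))) k ≤ (N₀ + 1 : ℕ) * C :=
          selfConv_comp_div_le h0 hC hm k
      _ ≤ (N₀ + 1 : ℕ) * C + η * (n * (N₀ + 1 : ℕ)) := by linarith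
      _ = (C / n + η) * (n * (N₀ + 1 : ℕ)) := by field_simp

/-- Densities on eight equal intervals, with total mass `11 / 2` and self-convolution at most `3`;
scaled by `16 / 11 * ε` they give the sets behind the constant `96 / 121`. -/
noncomputable def blockDensity : ℕ → ℝ
  | 0 => 1
  | 1 => 1
  | 2 => 1
  | 4 => 1
  | 5 => 1 / 2
  | 7 => 1
  | _ => 0

theorem blockDensity_nonneg (a : ℕ) : 0 ≤ blockDensity a := by
  unfold blockDensity
  split <;> norm_num

theorem blockDensity_le_one (a : ℕ) : blockDensity a ≤ 1 := by
  unfold blockDensity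
  split <;> norm_num

theorem blockDensity_eq_zero {a : ℕ} (h : 8 ≤ a) : blockDensity a = 0 := by
  unfold blockDensity
  split <;> first | omega | rfl

theorem sum_blockDensity : ∑ a ∈ range 8, blockDensity a = 11 / 2 := by
  norm_num [sum_range_succ, blockDensity]

theorem selfConv_blockDensity_le (k : ℕ) : selfConv blockDensity k ≤ 3 := by
  by_cases hk : k < 15
  · rw [selfConv, Nat.sum_antidiagonal_eq_sum_range_succ_mk]
    interval_cases k <;> norm_num [sum_range_succ, blockDensity]
  · refine (sum_eq_zero fun ij hij => ?_).trans_le zero_le_three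
    rw [HasAntidiagonal.mem_antidiagonal] at hij
    rcases le_or_gt 8 ij.1 with h | h
    · rw [blockDensity_eq_zero h, zero_mul]
    · rw [blockDensity_eq_zero (a := ij.2) (by omega), mul_zero]

theorem hasThinSets_blockDensity {ε : ℝ} (h0 : 0 ≤ ε) (h1 : ε ≤ 11 / 16) :
    HasThinSets ε (96 / 121 * ε ^ 2) := by
  have hthin := hasThinSets_of_blocks (n := 8) (q := fun a => 16 / 11 * ε * blockDensity a)
    (C := (16 / 11 * ε) ^ 2 * 3) (by norm_num)
    (fun a => mul_nonneg (by positivity) (blockDensity_nonneg a))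
    (fun a => mul_le_one₀ (by linarith) (blockDensity_nonneg a) (blockDensity_le_one a))
    (fun a ha => by rw [blockDensity_eq_zero ha, mul_zero])
    (fun k => by rw [selfConv_const_mul]; gcongr; exact selfConv_blockDensity_le k)
  rw [← mul_sum, sum_blockDensity] at hthin
  convert hthin using 1 <;> push_cast <;> ring

end Blocks

section InverseSquareRoot

open Finset Real

theorem hasDerivAt_arcsin_two_mul_div_sub_one {n x : ℝ} (hx : 0 < x) (hxn : x < n) :
    HasDerivAt (fun x => arcsin (2 * x / n - 1)) (1 / √(x * (n - x))) x := by
  have hn : 0 < n := hx.trans hxn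
  have hlower : 2 * x / n - 1 ≠ -1 := by
    have : 0 < 2 * x / n := by positivity
    linarith
  have hupper : 2 * x / n - 1 ≠ 1 := by
    have : 2 * x / n < 2 := by rw [div_lt_iff₀ hn]; linarith
    linarith
  have haffine : HasDerivAt (fun x : ℝ => 2 * x / n - 1) (2 / n) x := by
    simpa using (((hasDerivAt_id x).const_mul 2).div_const n).sub_const 1
  have hsqrt : √(1 - (2 * x / n - 1) ^ 2) = 2 / n * √(x * (n - x)) := by
    rw [show 1 - (2 * x / n - 1) ^ 2 = (2 / n) ^ 2 * (x * (n - x)) by field_simp; ring,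
      sqrt_mul (sq_nonneg _), sqrt_sq (by positivity)]
  have hpos : 0 < √(x * (n - x)) := sqrt_pos.2 (mul_pos hx (by linarith))
  convert! (hasDerivAt_arcsin hlower hupper).comp x haffine using 1
  rw [hsqrt]
  field_simp

theorem one_div_sqrt_le_arcsin_sub {n x : ℝ} (hx : 0 ≤ x) (hxn : x + 1 ≤ n) :
    1 / √((x + 1) * (n - x)) ≤ arcsin (2 * (x + 1) / n - 1) - arcsin (2 * x / n - 1) := by
  have hderiv : ∀ y ∈ interior (Set.Icc x (x + 1)),
      HasDerivAt (fun y => arcsin (2 * y / n - 1)) (1 / √(y * (n - y))) y := fun y hy => by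
    rw [interior_Icc] at hy
    exact hasDerivAt_arcsin_two_mul_div_sub_one (by linarith [hy.1]) (by linarith [hy.2])
  have hmean := (convex_Icc x (x + 1)).mul_sub_le_image_sub_of_le_deriv
    (f := fun y => arcsin (2 * y / n - 1)) (C := 1 / √((x + 1) * (n - x)))
    (continuous_arcsin.comp (by fun_prop)).continuousOn
    (fun y hy => (hderiv y hy).differentiableAt.differentiableWithinAt)
    (fun y hy => by
      rw [(hderiv y hy).deriv]
      rw [interior_Icc] at hy
      have hpos : 0 < y * (n - y) := mul_pos (by linarith [hy.1]) (by linarith [hy.2])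
      exact one_div_le_one_div_of_le (sqrt_pos.2 hpos) (sqrt_le_sqrt (mul_le_mul hy.2.le
        (by linarith [hy.1]) (by linarith [hy.2]) (by linarith))))
    x (by simp) (x + 1) (by simp) (by linarith)
  simpa using hmean

theorem selfConv_one_div_sqrt_le_pi (k : ℕ) : selfConv (fun i => 1 / √(i + 1)) k ≤ π := by
  rw [selfConv, Nat.sum_antidiagonal_eq_sum_range_succ_mk]
  calc ∑ i ∈ range (k + 1), 1 / √(i + 1) * (1 / √((k - i : ℕ) + 1))
      ≤ ∑ i ∈ range (k + 1), (arcsin (2 * (i + 1 : ℕ) / (k + 1) - 1) -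
          arcsin (2 * i / (k + 1) - 1)) := sum_le_sum fun i hi => by
        have hik : i ≤ k := Nat.lt_succ_iff.1 (mem_range.1 hi)
        have hik' : (i : ℝ) ≤ k := mod_cast hik
        rw [one_div_mul_one_div, ← sqrt_mul (by positivity), Nat.cast_sub hik,
          sub_add_eq_add_sub, Nat.cast_succ]
        exact one_div_sqrt_le_arcsin_sub i.cast_nonneg (by linarith)
    _ = π := by
        rw [sum_range_sub fun i : ℕ => arcsin (2 * i / (k + 1) - 1)]
        have hend : (2 : ℝ) * (k + 1 : ℕ) / (k + 1) - 1 = 1 := by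
          push_cast
          field_simp
          norm_num
        rw [hend]
        norm_num

theorem selfConv_mono {x y : ℕ → ℝ} (hx : ∀ i, 0 ≤ x i) (hxy : ∀ i, x i ≤ y i) (k : ℕ) :
    selfConv x k ≤ selfConv y k :=
  sum_le_sum fun _ _ => mul_le_mul (hxy _) (hxy _) (hx _) ((hx _).trans (hxy _))

/-- The left side is the concave function `u ↦ ∫ v in 0..u, min 1 (B / √v)` at `u = s ^ 2`, the
right side its tangent line at `u = c ^ 2`. -/
theorem sq_sub_max_sq_le {B c s : ℝ} (hB : 0 < B) (hc : B ≤ c) (hs : 0 ≤ s) :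
    s ^ 2 - max 0 (s - B) ^ 2 ≤ B / c * s ^ 2 + B * c - B ^ 2 := by
  have hc0 : 0 < c := hB.trans_le hc
  rw [show B / c * s ^ 2 + B * c - B ^ 2 = (B * s ^ 2 + B * c ^ 2 - B ^ 2 * c) / c by field_simp,
    le_div_iff₀ hc0]
  rcases le_total s B with h | h
  · rw [max_eq_left (by linarith)]
    have hsB : s ^ 2 ≤ B * c := by nlinarith
    nlinarith [mul_nonneg (sub_nonneg.2 hc) (sub_nonneg.2 hsB)]
  · rw [max_eq_right (by linarith)]
    nlinarith [mul_nonneg hB.le (sq_nonneg (s - c))]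

theorem sq_sub_max_sq_eq {B s : ℝ} (hB : 0 < B) :
    B / max B s * s ^ 2 + B * max B s - B ^ 2 = s ^ 2 - max 0 (s - B) ^ 2 := by
  rcases le_total s B with h | h
  · rw [max_eq_left h, max_eq_left (by linarith)]
    field_simp
    ring
  · have : 0 < s := hB.trans_le h
    rw [max_eq_right h, max_eq_right (by linarith)]
    field_simp
    ring

theorem two_mul_sqrt_sub_le_sum {B : ℝ} (hB : 0 < B) {N : ℕ} (hN : B ≤ √N) :
    2 * B * √N - B ^ 2 - 1 ≤ ∑ i ∈ range N, B / max B √(i + 1) := by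
  set Φ : ℝ → ℝ := fun x => √x ^ 2 - max 0 (√x - B) ^ 2 with hΦ
  have hstep (i : ℕ) : Φ ((i + 1 : ℕ) + 1) - Φ (i + 1) ≤ B / max B √(i + 1) := by
    have htangent := sq_sub_max_sq_le hB (le_max_left B √(i + 1)) (sqrt_nonneg ((i + 1 : ℕ) + 1))
    have hcontact := sq_sub_max_sq_eq (s := √(i + 1)) hB
    rw [sq_sqrt (by positivity)] at htangent hcontact
    simp only [hΦ]
    rw [sq_sqrt (by positivity), sq_sqrt (by positivity)]
    push_cast at htangent ⊢
    linarith
  have hmono : √N ≤ √(N + 1) := sqrt_le_sqrt (by linarith)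
  calc 2 * B * √N - B ^ 2 - 1 ≤ 2 * B * √(N + 1) - B ^ 2 - 1 := by gcongr
    _ ≤ Φ (N + 1) - Φ ((0 : ℕ) + 1) := by
        simp only [hΦ]
        rw [max_eq_right (by linarith)]
        norm_num
        nlinarith [sq_nonneg (max 0 (1 - B))]
    _ = ∑ i ∈ range N, (Φ ((i + 1 : ℕ) + 1) - Φ (i + 1)) :=
        (sum_range_sub (fun i : ℕ => Φ (i + 1)) N).symm
    _ ≤ ∑ i ∈ range N, B / max B √(i + 1) := sum_le_sum fun i _ => hstep i

/-- The density `min 1 (b / √x)` on `[0, 1]`, sampled at the points `(i + 1) / N` with `i < N`. -/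
noncomputable def invSqrtDensity (b : ℝ) (N : ℕ) : ℕ → ℝ :=
  (Set.Iio N).indicator fun i => b * √N / max (b * √N) √(i + 1)

variable {b : ℝ} {N : ℕ}

theorem invSqrtDensity_nonneg (hb : 0 ≤ b) (i : ℕ) : 0 ≤ invSqrtDensity b N i :=
  Set.indicator_nonneg (fun _ _ => by positivity) i

theorem invSqrtDensity_le_one (i : ℕ) : invSqrtDensity b N i ≤ 1 :=
  Set.indicator_le' (fun _ _ => div_le_one_of_le₀ (le_max_left _ _) (by positivity))
    (fun _ _ => zero_le_one) i

theorem selfConv_invSqrtDensity_le (hb : 0 ≤ b) (k : ℕ) :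
    selfConv (invSqrtDensity b N) k ≤ π * b ^ 2 * N := by
  have hle (i : ℕ) : invSqrtDensity b N i ≤ b * √N * (1 / √(i + 1)) := by
    rw [mul_one_div]
    refine (Set.indicator_le_self' (fun i _ => by positivity) i).trans ?_
    gcongr
    exact le_max_right _ _
  calc selfConv (invSqrtDensity b N) k
      ≤ (b * √N) ^ 2 * selfConv (fun i => 1 / √(i + 1)) k :=
        (selfConv_mono (invSqrtDensity_nonneg hb) hle k).trans_eq (selfConv_const_mul _ _ k)
    _ ≤ (b * √N) ^ 2 * π := by gcongr; exact selfConv_one_div_sqrt_le_pi k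
    _ = π * b ^ 2 * N := by rw [mul_pow, sq_sqrt N.cast_nonneg]; ring

theorem sub_one_le_sum_invSqrtDensity (hb0 : 0 < b) (hb1 : b ≤ 1) (hN : 0 < N) :
    (2 * b - b ^ 2) * N - 1 ≤ ∑ i ∈ range N, invSqrtDensity b N i := by
  have hsqrt : 0 < √(N : ℝ) := sqrt_pos.2 (mod_cast hN)
  have hsum := two_mul_sqrt_sub_le_sum (mul_pos hb0 hsqrt) (mul_le_of_le_one_left hsqrt.le hb1)
  have hsq : √(N : ℝ) ^ 2 = N := sq_sqrt N.cast_nonneg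
  calc (2 * b - b ^ 2) * N - 1 = 2 * (b * √N) * √N - (b * √N) ^ 2 - 1 := by
        linear_combination -(2 * b - b ^ 2) * hsq
    _ ≤ ∑ i ∈ range N, b * √N / max (b * √N) √(i + 1) := hsum
    _ = ∑ i ∈ range N, invSqrtDensity b N i := sum_congr rfl fun i hi => by
        rw [invSqrtDensity, Set.indicator_of_mem (Set.mem_Iio.2 (mem_range.1 hi))]

theorem hasThinSets_invSqrt (hb0 : 0 < b) (hb1 : b ≤ 1) :
    HasThinSets (2 * b - b ^ 2) (π * b ^ 2) := by
  refine hasThinSets_of_densities fun η hη => Filter.Eventually.frequently ?_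
  have hlarge : ∀ᶠ N : ℕ in Filter.atTop, 1 ≤ η * (N : ℝ) :=
    (tendsto_natCast_atTop_atTop.const_mul_atTop hη).eventually_ge_atTop 1
  filter_upwards [hlarge, Filter.eventually_gt_atTop 0] with N hηN hN
  refine ⟨invSqrtDensity b N, invSqrtDensity_nonneg hb0.le, invSqrtDensity_le_one,
    fun i hi => Set.indicator_of_notMem (by simpa using hi) _, ?_, fun k => ?_⟩
  · linarith [sub_one_le_sum_invSqrtDensity hb0 hb1 hN]
  · linarith [selfConv_invSqrtDensity_le (N := N) hb0.le k]

end InverseSquareRoot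

section Bounds

variable {ε : ℝ}

theorem cubic_le_symDelta (h0 : 0 ≤ ε) (h1 : ε ≤ 1) :
    0.5546 * ε ^ 2 + 0.088079 * ε ^ 3 ≤ symDelta ε := by
  rcases le_total ε 0.616 with h | h
  · calc 0.5546 * ε ^ 2 + 0.088079 * ε ^ 3 = (0.5546 + 0.088079 * ε) * ε ^ 2 := by ring
      _ ≤ 0.609 * ε ^ 2 := by gcongr; linarith
      _ ≤ symDelta ε := mul_sq_le_symDelta h0 h1
  · refine le_trans ?_ (two_mul_sub_one_le_symDelta (by linarith) h1)
    have hfactor : 0 ≤ (ε - 0.616) * (1 - ε) :=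
      mul_nonneg (sub_nonneg.2 h) (sub_nonneg.2 h1)
    linarith [mul_nonneg h0 hfactor]

theorem symDelta_le_mul_sq (h0 : 0 ≤ ε) (h1 : ε ≤ 11 / 16) : symDelta ε ≤ 96 / 121 * ε ^ 2 := by
  simpa using (hasThinSets_blockDensity h0 h1).symDelta_le (by positivity) h0 le_rfl (by linarith)

theorem symDelta_le_two_mul_sub_one (h0 : 11 / 16 ≤ ε) (h1 : ε ≤ 1) :
    symDelta ε ≤ 2 * ε - 1 := by
  have hthin := hasThinSets_blockDensity (ε := 11 / 16) (by norm_num) le_rfl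
  linarith [hthin.symDelta_le (by norm_num) (by linarith) h0 h1]

theorem symDelta_le_pi_mul (h0 : 0 < ε) (h1 : ε ≤ 1) :
    symDelta ε ≤ Real.pi * ε ^ 2 / (1 + √(1 - ε)) ^ 2 := by
  have hsq := Real.sq_sqrt (sub_nonneg.2 h1)
  have hnonneg := Real.sqrt_nonneg (1 - ε)
  set r := √(1 - ε)
  have hfactor : ε = (1 - r) * (1 + r) := by linarith
  have hr : r < 1 := by nlinarith
  have hthin := hasThinSets_invSqrt (b := 1 - r) (by linarith) (by linarith)
  rw [show 2 * (1 - r) - (1 - r) ^ 2 = ε by linarith] at hthin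
  calc symDelta ε ≤ Real.pi * (1 - r) ^ 2 := by
        simpa using hthin.symDelta_le (by positivity) h0.le le_rfl h1
    _ = Real.pi * ε ^ 2 / (1 + r) ^ 2 := by
        rw [hfactor]
        field_simp

theorem abs_pi_mul_sub_le (h0 : 0 ≤ ε) (h1 : ε ≤ 1) :
    |Real.pi * ε ^ 2 / (1 + √(1 - ε)) ^ 2 - Real.pi / 4 * ε ^ 2| ≤ Real.pi * ε ^ 3 := by
  have hsq := Real.sq_sqrt (sub_nonneg.2 h1)
  have hnonneg := Real.sqrt_nonneg (1 - ε)
  set r := √(1 - ε)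
  have hfactor : ε = (1 - r) * (1 + r) := by linarith
  have hr : 0 ≤ 1 - r := by nlinarith
  have hdiff : Real.pi * ε ^ 2 / (1 + r) ^ 2 - Real.pi / 4 * ε ^ 2 =
      Real.pi * ε ^ 2 * ((1 - r) * (3 + r) / (4 * (1 + r) ^ 2)) := by
    field_simp
    ring
  have hle : (1 - r) * (3 + r) / (4 * (1 + r) ^ 2) ≤ ε := by
    rw [div_le_iff₀ (by positivity), hfactor, mul_assoc]
    gcongr
    nlinarith [sq_nonneg r, pow_nonneg hnonneg 3]
  rw [hdiff, abs_of_nonneg (by positivity), pow_succ ε 2, ← mul_assoc]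
  gcongr

end Bounds

theorem theorem1 :
    ((∀ ε : ℝ, 11 / 16 ≤ ε → ε ≤ 1 → symDelta ε = 2 * ε - 1) ∧
      (∀ ε : ℝ, 1 / 2 ≤ ε → ε ≤ 11 / 16 → 2 * ε - 1 ≤ symDelta ε)) ∧
    (∀ ε : ℝ, 0 < ε → ε ≤ 1 → 0.591389 * ε ^ 2 ≤ symDelta ε) ∧
    (∀ ε : ℝ, 0 < ε → ε ≤ 1 → 0.5546 * ε ^ 2 + 0.088079 * ε ^ 3 ≤ symDelta ε) ∧
    (∀ ε : ℝ, 0 < ε → ε ≤ 11 / 16 →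
      symDelta ε ≤ 96 / 121 * ε ^ 2 ∧ 96 / 121 * ε ^ 2 < 0.7934 * ε ^ 2) ∧
    ((∀ ε : ℝ, 0 < ε → ε ≤ 1 →
        symDelta ε ≤ Real.pi * ε ^ 2 / (1 + Real.sqrt (1 - ε)) ^ 2) ∧
      (∃ K : ℝ, ∀ ε : ℝ, 0 < ε → ε ≤ 1 →
        |Real.pi * ε ^ 2 / (1 + Real.sqrt (1 - ε)) ^ 2 - Real.pi / 4 * ε ^ 2| ≤ K * ε ^ 3)) := by
  refine ⟨⟨fun ε h0 h1 => le_antisymm (symDelta_le_two_mul_sub_one h0 h1)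
    (two_mul_sub_one_le_symDelta (by linarith) h1),
    fun ε h0 h1 => two_mul_sub_one_le_symDelta h0 (by linarith)⟩, fun ε h0 h1 => ?_,
    fun ε h0 h1 => cubic_le_symDelta h0.le h1,
    fun ε h0 h1 => ⟨symDelta_le_mul_sq h0.le h1, by gcongr; norm_num⟩,
    fun ε h0 h1 => symDelta_le_pi_mul h0 h1,
    Real.pi, fun ε h0 h1 => abs_pi_mul_sub_le h0.le h1⟩
  calc 0.591389 * ε ^ 2 ≤ 0.609 * ε ^ 2 := by gcongr; norm_num
    _ ≤ symDelta ε := mul_sq_le_symDelta h0.le h1
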